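/- Let $D\ge 1$, let $U\subseteq\mathbb R$ be a nonempty connected open set, and let $\xi_1,\dots,\xi_D$ be the standard basis of $Z=\mathbb Z_{\ge0}^D$; for $S=\sum_i s_i\xi_i\in Z$ put $|S|=\sum_i s_i$. Let $$\hat{\mathcal A}=C^\infty(U)[[\{u^S,\ |S|>0\}\cup\{\theta^S,\ |S|\ge0\}]]$$ be the algebra of formal power series in commuting variables $u^S$ and anticommuting variables $\theta^S$, with coefficients smooth functions of $u=u^0\in U$. It is bigraded by $\deg_\theta\theta^S=1$, $\deg_\theta u^S=0$ and $\deg u^S=\deg\theta^S=|S|$; $\hat{\mathcal A}^p_d$ denotes the component of $\deg_\theta=p$ and $\deg=d$ (zero if $p<0$ or $d<0$). Consider the operators on $\hat{\mathcal A}$ $$\partial_{x^j}=\sum_{S\in Z}\Big(u^{S+\xi_j}\frac{\partial}{\partial u^S}+\theta^{S+\xi_j}\frac{\partial}{\partial\theta^S}\Big)\quad(1\le j\le D),\qquad \Delta=\sum_{S\in Z}\theta^{S+\xi_D}\frac{\partial}{\partial u^S}.$$ Then $\Delta^2=0$ and $\Delta$ commutes with every $\partial_{x^j}$, so $\Delta$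 induces a differential, of bidegree $(1,1)$, on each $$\hat{\mathcal F}_i=\hat{\mathcal A}/(\partial_{x^1}\hat{\mathcal A}+\dots+\partial_{x^i}\hat{\mathcal A}).$$ Let $(\hat{\mathcal F}_i)^p_d$ be the image of $\hat{\mathcal A}^p_d$ in $\hat{\mathcal F}_i$, and let $$H^p_d(\hat{\mathcal F}_i)=\frac{\ker\big(\Delta:(\hat{\mathcal F}_i)^p_d\to(\hat{\mathcal F}_i)^{p+1}_{d+1}\big)}{\Delta\big((\hat{\mathcal F}_i)^{p-1}_{d-1}\big)},\qquad H(\hat{\mathcal F}_i)=\bigoplus_{p,d}H^p_d(\hat{\mathcal F}_i).$$ Finally let $\Theta=\mathbb R[\{\theta^S:\ S\in Z,\ s_D=0\}]\subset\hat{\mathcal A}$ be the ring of polynomials with real coefficients in the anticommuting variables $\theta^S$ with $s_D=0$, and $\Theta^p_d=\Theta\cap\hat{\mathcal A}^p_d$. **Proposition.** Let $1\le i\le D-1$. For all $p,d$ the map that sends an element of $\Theta^p_d$ to the class it represents in $H^p_d(\hat{\mathcal F}_i)$ induces an isomorphism of real vector spaces $$\frac{\Theta^p_d}{\partial_{x^1}\Theta^p_{d-1}+\dots+\partial_{x^i}\Theta^p_{d-1}}\;\cong\;H^p_d(\hat{\mathcal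 F}_i),$$ and these maps together induce an isomorphism $$\frac{\Theta}{\partial_{x^1}\Theta+\dots+\partial_{x^i}\Theta}\;\cong\;H(\hat{\mathcal F}_i).$$ -/

import Mathlib

open scoped Manifold ContDiff DirectSum

noncomputable section

namespace DNBracket

/-- Multi-indices `S = ∑ s_i ξ_i`, the elements of the semiring `ℤ_{≥0}^D`. -/
abbrev MIdx (D : ℕ) := Fin D → ℕ

/-- The basis multi-index `ξ_i`. -/
def xi {D : ℕ} (i : Fin D) : MIdx D := Pi.single i 1

theorem add_xi_ne_zero {D : ℕ} (S : MIdx D) (i : Fin D) : S + xi i ≠ 0 := by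
  intro h
  have := congrFun h i
  simp [xi] at this

/-- The length `|S|` of a multi-index. -/
def len {D : ℕ} (S : MIdx D) : ℕ := ∑ i, S i

/-! ### Smooth functions of `u` -/

/-- The ring `C^∞(U)` of smooth real functions of `u ∈ U ⊆ ℝ`. -/
abbrev SmoothFn (U : TopologicalSpace.Opens ℝ) := C^∞⟮𝓘(ℝ, ℝ), U; 𝓘(ℝ, ℝ), ℝ⟯

/-- A function on `U`, extended by zero to `ℝ`. -/
def extendZero {U : TopologicalSpace.Opens ℝ} (f : SmoothFn U) : ℝ → ℝ :=
  Function.extend Subtype.val (f : U → ℝ) 0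

theorem extendZero_apply {U : TopologicalSpace.Opens ℝ} (f : SmoothFn U) (x : U) :
    extendZero f (x : ℝ) = f x :=
  Subtype.val_injective.extend_apply _ _ _

theorem contDiffAt_extendZero {U : TopologicalSpace.Opens ℝ} (f : SmoothFn U) (x : U) :
    ContDiffAt ℝ ∞ (extendZero f) (x : ℝ) := by
  rw [← contMDiffAt_iff_contDiffAt, ← contMDiffAt_subtype_iff]
  have : (fun x : U => extendZero f (x : ℝ)) = f := funext (extendZero_apply f)
  rw [this]
  exact f.contMDiff.contMDiffAt

theorem extendZero_eventuallyEq {U : TopologicalSpace.Opens ℝ} (x : U) {g : ℝ → ℝ}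
    {f : SmoothFn U} (h : ∀ y : U, f y = g y) :
    extendZero f =ᶠ[nhds (x : ℝ)] g := by
  filter_upwards [U.isOpen.mem_nhds x.2] with y hy
  exact (extendZero_apply f ⟨y, hy⟩).trans (h ⟨y, hy⟩)

/-- The derivative `f'` of `f ∈ C^∞(U)`. -/
def dUFun {U : TopologicalSpace.Opens ℝ} (f : SmoothFn U) : SmoothFn U :=
  ⟨fun x : U => deriv (extendZero f) (x : ℝ), by
    intro x
    have h : ContDiffAt ℝ ∞ (deriv (extendZero f)) (x : ℝ) :=
      (contDiffAt_extendZero f x).derivWithin (by norm_num)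
    exact contMDiffAt_subtype_iff.mpr h.contMDiffAt⟩

theorem dUFun_apply {U : TopologicalSpace.Opens ℝ} (f : SmoothFn U) (x : U) :
    dUFun f x = deriv (extendZero f) (x : ℝ) :=
  rfl

/-- The derivative `∂/∂u = d/du` on `C^∞(U)`, as a linear map. -/
def dU (U : TopologicalSpace.Opens ℝ) : SmoothFn U →ₗ[ℝ] SmoothFn U where
  toFun f := dUFun f
  map_add' f g := by
    ext x
    have h : extendZero (f + g) =ᶠ[nhds (x : ℝ)] extendZero f + extendZero g :=
      extendZero_eventuallyEq x fun y => by simp [extendZero_apply]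
    rw [ContMDiffMap.coe_add, Pi.add_apply, dUFun_apply, dUFun_apply, dUFun_apply,
      h.deriv_eq, deriv_add]
    · exact (contDiffAt_extendZero f x).differentiableAt (by norm_num)
    · exact (contDiffAt_extendZero g x).differentiableAt (by norm_num)
  map_smul' c f := by
    ext x
    have h : extendZero (c • f) =ᶠ[nhds (x : ℝ)] c • extendZero f :=
      extendZero_eventuallyEq x fun y => by simp [extendZero_apply]
    rw [RingHom.id_apply, ContMDiffMap.coe_smul, Pi.smul_apply, dUFun_apply, dUFun_apply,
      h.deriv_eq, deriv_const_smul]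
    exact (contDiffAt_extendZero f x).differentiableAt (by norm_num)

/-- The coordinate function `u` on `U`. -/
def coordU (U : TopologicalSpace.Opens ℝ) : SmoothFn U :=
  ⟨fun x : U => (x : ℝ), contMDiff_subtype_val⟩

/-! ### Formal power series in the jet variables -/

/-- Differential functions `C^∞(U)[[u^S, |S| > 0]]`. -/
abbrev DiffPoly (D : ℕ) (U : TopologicalSpace.Opens ℝ) :=
  MvPowerSeries {S : MIdx D // S ≠ 0} (SmoothFn U)

/-- The derivation `∂/∂u^S`; for `S = 0` it differentiates the coefficients with respect
to `u = u^0`. -/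
def derU {D : ℕ} {U : TopologicalSpace.Opens ℝ} (S : MIdx D) :
    DiffPoly D U →ₗ[ℝ] DiffPoly D U :=
  if h : S = 0 then
    { toFun := fun a n => dU U (MvPowerSeries.coeff n a)
      map_add' := fun a b => by
        funext n
        exact (congrArg (dU U) (map_add _ a b)).trans (map_add _ _ _)
      map_smul' := fun c a => by
        funext n
        exact (dU U).map_smul c (MvPowerSeries.coeff n a) }
  else (MvPowerSeries.pderiv (σ := {S : MIdx D // S ≠ 0}) (SmoothFn U)
    ⟨S, h⟩).toLinearMap.restrictScalars ℝ

/-- The jet variable `u^S`; for `S = 0` it is the coordinate function `u` on `U`. -/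
def jet {D : ℕ} {U : TopologicalSpace.Opens ℝ} (S : MIdx D) : DiffPoly D U :=
  if h : S = 0 then MvPowerSeries.C (coordU U)
  else MvPowerSeries.X ⟨S, h⟩

/-! ### Formal power series in jet variables and anticommuting variables -/

/-- The space `C^∞(U)[[{u^S, |S| > 0} ∪ {θ^S, |S| ≥ 0}]]`. A finite set
`T = {S_1 < ⋯ < S_p}` of multi-indices (in lexicographic order) stands for the monomial
`θ^{S_1} ⋯ θ^{S_p}`, and `f` stands for the formal sum of `f T • θ^{S_1} ⋯ θ^{S_p}` over
all finite `T`. -/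
abbrev Ahat (D : ℕ) (U : TopologicalSpace.Opens ℝ) := Finset (MIdx D) → DiffPoly D U

open Classical in
/-- The sign with `θ^R θ^{S_1} ⋯ θ^{S_p} = sgn R T • θ^{T ∪ {R}}`, for `T = {S_1 < ⋯ < S_p}`
and `R ∉ T`. -/
def sgn {D : ℕ} (R : MIdx D) (T : Finset (MIdx D)) : ℝ :=
  (-1) ^ (T.filter fun S => toLex S < toLex R).card

/-- Left multiplication by `θ^R`. -/
def thetaMul {D : ℕ} {U : TopologicalSpace.Opens ℝ} (R : MIdx D) : Ahat D U →ₗ[ℝ] Ahat D U where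
  toFun f T := if R ∈ T then sgn R (T.erase R) • f (T.erase R) else 0
  map_add' f g := by
    funext T
    by_cases h : R ∈ T <;> simp [h]
  map_smul' c f := by
    funext T
    by_cases h : R ∈ T <;> simp [h, smul_comm c]

/-- The left derivative `∂/∂θ^R`. -/
def thetaDer {D : ℕ} {U : TopologicalSpace.Opens ℝ} (R : MIdx D) : Ahat D U →ₗ[ℝ] Ahat D U where
  toFun f T := if R ∈ T then 0 else sgn R T • f (insert R T)
  map_add' f g := by
    funext T
    by_cases h : R ∈ T <;> simp [h]
  map_smul' c f := by
    funext T
    by_cases h : R ∈ T <;> simp [h, smul_comm c]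

/-- Multiplication by `u^R`. -/
def jetMul {D : ℕ} {U : TopologicalSpace.Opens ℝ} (R : MIdx D) : Ahat D U →ₗ[ℝ] Ahat D U where
  toFun f T := jet R * f T
  map_add' f g := by
    funext T
    simp [mul_add]
  map_smul' c f := by
    funext T
    simp

/-- The derivative `∂/∂u^R`. -/
def jetDer {D : ℕ} {U : TopologicalSpace.Opens ℝ} (R : MIdx D) : Ahat D U →ₗ[ℝ] Ahat D U where
  toFun f T := derU R (f T)
  map_add' f g := by
    funext T
    simp
  map_smul' c f := by
    funext T
    simp

/-- A family of operators such that every given coefficient of the output is nonzero for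
only finitely many members of the family. -/
def LocallyFinite {D : ℕ} {U : TopologicalSpace.Opens ℝ}
    (L : MIdx D → Ahat D U →ₗ[ℝ] Ahat D U) : Prop :=
  ∀ (T : Finset (MIdx D)) (n : {S : MIdx D // S ≠ 0} →₀ ℕ),
    {S | ∃ f, MvPowerSeries.coeff n (L S f T) ≠ 0}.Finite

theorem LocallyFinite.finite {D : ℕ} {U : TopologicalSpace.Opens ℝ}
    {L : MIdx D → Ahat D U →ₗ[ℝ] Ahat D U} (hL : LocallyFinite L) (f : Ahat D U)
    (T : Finset (MIdx D)) (n : {S : MIdx D // S ≠ 0} →₀ ℕ) :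
    (Function.support fun S => MvPowerSeries.coeff n (L S f T)).Finite :=
  (hL T n).subset fun _ hS => ⟨f, hS⟩

/-- The sum of a locally finite family of operators, coefficient by coefficient. -/
def sumOp {D : ℕ} {U : TopologicalSpace.Opens ℝ}
    (L : MIdx D → Ahat D U →ₗ[ℝ] Ahat D U) (hL : LocallyFinite L) : Ahat D U →ₗ[ℝ] Ahat D U where
  toFun f T := fun n => ∑ᶠ S, MvPowerSeries.coeff n (L S f T)
  map_add' f g := by
    funext T n
    refine Eq.trans ?_ (finsum_add_distrib (hL.finite f T n) (hL.finite g T n))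
    simp
  map_smul' c f := by
    funext T n
    refine Eq.trans ?_ (smul_finsum' c (hL.finite f T n)).symm
    exact finsum_congr fun S => by rw [map_smul]; rfl

theorem coeff_sumOp {D : ℕ} {U : TopologicalSpace.Opens ℝ}
    (L : MIdx D → Ahat D U →ₗ[ℝ] Ahat D U) (hL : LocallyFinite L) (f : Ahat D U)
    (T : Finset (MIdx D)) (n : {S : MIdx D // S ≠ 0} →₀ ℕ) :
    MvPowerSeries.coeff n (sumOp L hL f T) = ∑ᶠ S, MvPowerSeries.coeff n (L S f T) :=
  rfl

theorem finite_add_xi {D : ℕ} (i : Fin D) {s : Set (MIdx D)} (hs : s.Finite) :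
    {S : MIdx D | S + xi i ∈ s}.Finite :=
  hs.preimage fun _ _ _ _ h => add_right_cancel h

theorem coeff_jetMul_eq_zero {D : ℕ} {U : TopologicalSpace.Opens ℝ} {R : MIdx D} (hR : R ≠ 0)
    (f : Ahat D U) (T : Finset (MIdx D)) (n : {S : MIdx D // S ≠ 0} →₀ ℕ)
    (h : R ∉ Subtype.val '' (n.support : Set {S : MIdx D // S ≠ 0})) :
    MvPowerSeries.coeff n (jetMul R f T) = 0 := by
  have h0 : n ⟨R, hR⟩ = 0 := by
    by_contra h1
    exact h ⟨⟨R, hR⟩, by simpa using h1, rfl⟩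
  change MvPowerSeries.coeff n (jet R * f T) = 0
  rw [jet, dif_neg hR, MvPowerSeries.X, MvPowerSeries.coeff_monomial_mul, if_neg]
  intro hle
  have := hle ⟨R, hR⟩
  simp [h0] at this

theorem thetaMul_eq_zero {D : ℕ} {U : TopologicalSpace.Opens ℝ} {R : MIdx D}
    (f : Ahat D U) {T : Finset (MIdx D)} (h : R ∉ T) : thetaMul R f T = 0 :=
  if_neg h

/-- The derivation `u^{S+ξ_i} ∂/∂u^S + θ^{S+ξ_i} ∂/∂θ^S`. -/
def partialTerm {D : ℕ} {U : TopologicalSpace.Opens ℝ} (i : Fin D) (S : MIdx D) :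
    Ahat D U →ₗ[ℝ] Ahat D U :=
  jetMul (S + xi i) ∘ₗ jetDer S + thetaMul (S + xi i) ∘ₗ thetaDer S

/-- The derivation `θ^{S+ξ_k} ∂/∂u^S`. -/
def deltaTerm {D : ℕ} {U : TopologicalSpace.Opens ℝ} (k : Fin D) (S : MIdx D) :
    Ahat D U →ₗ[ℝ] Ahat D U :=
  thetaMul (S + xi k) ∘ₗ jetDer S

theorem locallyFinite_partialX {D : ℕ} {U : TopologicalSpace.Opens ℝ} (i : Fin D) :
    LocallyFinite (partialTerm (U := U) i) := by
  intro T n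
  refine (finite_add_xi i ((n.support.finite_toSet.image Subtype.val).union
    T.finite_toSet)).subset ?_
  rintro S ⟨f, hf⟩
  by_contra hS
  simp only [Set.mem_ofPred_eq, Set.mem_union, not_or] at hS
  refine hf ?_
  rw [partialTerm, LinearMap.add_apply, Pi.add_apply, map_add, LinearMap.comp_apply, LinearMap.comp_apply,
    coeff_jetMul_eq_zero (add_xi_ne_zero S i) _ _ _ hS.1, thetaMul_eq_zero _ (by simpa using hS.2)]
  simp

theorem locallyFinite_Delta {D : ℕ} {U : TopologicalSpace.Opens ℝ} (k : Fin D) :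
    LocallyFinite (deltaTerm (U := U) k) := by
  intro T n
  refine (finite_add_xi k T.finite_toSet).subset ?_
  rintro S ⟨f, hf⟩
  by_contra hS
  refine hf ?_
  rw [deltaTerm, LinearMap.comp_apply, thetaMul_eq_zero _ (by simpa using hS)]
  simp

/-- The total derivative
`∂_{x^i} = ∑_S (u^{S+ξ_i} ∂/∂u^S + θ^{S+ξ_i} ∂/∂θ^S)`. -/
def partialX {D : ℕ} {U : TopologicalSpace.Opens ℝ} (i : Fin D) : Ahat D U →ₗ[ℝ] Ahat D U :=
  sumOp (partialTerm i) (locallyFinite_partialX i)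

/-- The operator `∑_S θ^{S+ξ_k} ∂/∂u^S`. -/
def Delta {D : ℕ} {U : TopologicalSpace.Opens ℝ} (k : Fin D) : Ahat D U →ₗ[ℝ] Ahat D U :=
  sumOp (deltaTerm k) (locallyFinite_Delta k)

end DNBracket

section
namespace DNBracket
variable {D : ℕ} {U : TopologicalSpace.Opens ℝ}

/-! ### The differential commutes with the total derivatives -/

theorem sgn_mul_self (R : MIdx D) (T : Finset (MIdx D)) : sgn R T * sgn R T = 1 := by
  rw [sgn, ← pow_add, ← two_mul, pow_mul]
  norm_num

theorem sgn_insert {R Q : MIdx D} {T : Finset (MIdx D)} (h : Q ∉ T) :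
    sgn R (insert Q T) = sgn R {Q} * sgn R T := by
  classical
  unfold sgn
  rw [← pow_add, Finset.filter_insert, Finset.filter_singleton]
  by_cases h1 : toLex Q < toLex R
  · rw [if_pos h1, if_pos h1, Finset.card_insert_of_notMem (by simp [h]), Finset.card_singleton,
      add_comm]
  · rw [if_neg h1, if_neg h1, Finset.card_empty, zero_add]

theorem sgn_erase {R Q : MIdx D} {T : Finset (MIdx D)} (h : Q ∈ T) :
    sgn R (T.erase Q) = sgn R {Q} * sgn R T := by
  have h1 := sgn_insert (R := R) (Finset.notMem_erase Q T)
  rw [Finset.insert_erase h] at h1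
  rw [h1, ← mul_assoc, sgn_mul_self, one_mul]

theorem lex_trichotomy {R Q : MIdx D} (h : R ≠ Q) :
    (toLex R < toLex Q ∧ ¬ toLex Q < toLex R) ∨ (toLex Q < toLex R ∧ ¬ toLex R < toLex Q) := by
  rcases lt_trichotomy (toLex R) (toLex Q) with h1 | h1 | h1
  · exact Or.inl ⟨h1, lt_asymm h1⟩
  · exact absurd (toLex.injective h1) h
  · exact Or.inr ⟨h1, lt_asymm h1⟩

theorem sgn_singleton {R Q : MIdx D} (h : R ≠ Q) : sgn R {Q} = -sgn Q {R} := by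
  classical
  unfold sgn
  rw [Finset.filter_singleton, Finset.filter_singleton]
  rcases lex_trichotomy h with ⟨h1, h2⟩ | ⟨h1, h2⟩
  · rw [if_pos h1, if_neg h2]
    simp
  · rw [if_pos h1, if_neg h2]
    simp

theorem thetaMul_apply (R : MIdx D) (f : Ahat D U) (T : Finset (MIdx D)) :
    thetaMul R f T = if R ∈ T then sgn R (T.erase R) • f (T.erase R) else 0 :=
  rfl

theorem thetaDer_apply (R : MIdx D) (f : Ahat D U) (T : Finset (MIdx D)) :
    thetaDer R f T = if R ∈ T then 0 else sgn R T • f (insert R T) :=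
  rfl

theorem thetaMul_thetaMul (R Q : MIdx D) (f : Ahat D U) :
    thetaMul R (thetaMul Q f) = -thetaMul Q (thetaMul R f) := by
  funext T
  rw [Pi.neg_apply]
  simp only [thetaMul_apply, Finset.mem_erase]
  by_cases hR : R ∈ T
  · by_cases hQ : Q ∈ T
    · by_cases h : R = Q
      · subst h
        simp
      · rw [if_pos hR, if_pos ⟨Ne.symm h, hQ⟩, if_pos hQ, if_pos ⟨h, hR⟩, smul_smul, smul_smul,
          Finset.erase_right_comm, ← neg_smul]
        congr 1
        rw [sgn_erase (Finset.mem_erase.2 ⟨h, hR⟩ : R ∈ T.erase Q), Finset.erase_right_comm,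
          sgn_erase (Finset.mem_erase.2 ⟨Ne.symm h, hQ⟩ : Q ∈ T.erase R), sgn_singleton h]
        ring
    · simp [hQ]
  · simp [hR]

theorem thetaMul_thetaDer (R Q : MIdx D) (f : Ahat D U) :
    thetaMul Q (thetaDer R f) = (if Q = R then f else 0) - thetaDer R (thetaMul Q f) := by
  funext T
  rw [Pi.sub_apply]
  simp only [thetaMul_apply, thetaDer_apply]
  by_cases h : Q = R
  · subst h
    by_cases hQ : Q ∈ T
    · simp [hQ, smul_smul, sgn_mul_self]
    · simp [hQ, smul_smul, sgn_mul_self]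
  · by_cases hQ : Q ∈ T
    · by_cases hR : R ∈ T
      · simp [h, hQ, hR, Ne.symm h]
      · have e : (insert R T).erase Q = insert R (T.erase Q) := by
          ext x
          simp only [Finset.mem_erase, Finset.mem_insert]
          constructor
          · rintro ⟨h1, h2 | h2⟩
            · exact Or.inl h2
            · exact Or.inr ⟨h1, h2⟩
          · rintro (h1 | h1)
            · exact ⟨fun h2 => h (h2.symm.trans h1), Or.inl h1⟩
            · exact ⟨h1.1, Or.inr h1.2⟩
        have hR' : R ∉ T.erase Q := fun h1 => hR (Finset.mem_of_mem_erase h1)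
        rw [if_pos hQ, if_neg hR', if_neg h, if_neg hR, if_pos (Finset.mem_insert_of_mem hQ),
          Pi.zero_apply, zero_sub, smul_smul, smul_smul, e, ← neg_smul]
        congr 1
        rw [sgn_insert hR', sgn_erase (R := R) hQ, sgn_singleton (Ne.symm h)]
        ring
    · have hQ' : Q ∉ insert R T := by simp [h, hQ]
      simp [h, hQ, hQ']

theorem derU_zero_apply (a : DiffPoly D U) (n : {S : MIdx D // S ≠ 0} →₀ ℕ) :
    MvPowerSeries.coeff n (derU 0 a) = dU U (MvPowerSeries.coeff n a) := by
  rw [derU, dif_pos rfl]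
  rfl

theorem derU_apply {S : MIdx D} (h : S ≠ 0) (a : DiffPoly D U) :
    derU S a = MvPowerSeries.pderiv (σ := {S : MIdx D // S ≠ 0}) (SmoothFn U) ⟨S, h⟩ a := by
  rw [derU, dif_neg h]
  rfl

theorem coeff_derU {S : MIdx D} (h : S ≠ 0) (a : DiffPoly D U)
    (n : {S : MIdx D // S ≠ 0} →₀ ℕ) :
    MvPowerSeries.coeff n (derU S a) =
      ((n ⟨S, h⟩ + 1 : ℕ) : ℝ) • MvPowerSeries.coeff (n + Finsupp.single ⟨S, h⟩ 1) a := by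
  rw [derU_apply h, MvPowerSeries.coeff_pderiv, mul_comm, Nat.cast_smul_eq_nsmul, nsmul_eq_mul]
  push_cast
  rfl

theorem derU_comm (S R : MIdx D) (a : DiffPoly D U) : derU S (derU R a) = derU R (derU S a) := by
  by_cases hS : S = 0
  · subst hS
    by_cases hR : R = 0
    · subst hR
      rfl
    · ext1 n
      rw [derU_zero_apply, coeff_derU hR, coeff_derU hR, derU_zero_apply, map_smul]
  · by_cases hR : R = 0
    · subst hR
      ext1 n
      rw [derU_zero_apply, coeff_derU hS, coeff_derU hS, derU_zero_apply, map_smul]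
    · ext1 n
      rw [coeff_derU hS, coeff_derU hR, coeff_derU hR, coeff_derU hS, smul_smul, smul_smul,
        add_right_comm]
      congr 1
      by_cases h : S = R
      · subst h
        rfl
      · have h1 : (⟨R, hR⟩ : {S : MIdx D // S ≠ 0}) ≠ ⟨S, hS⟩ := fun h1 =>
          h (congrArg Subtype.val h1).symm
        simp only [Finsupp.add_apply, Finsupp.single_eq_of_ne h1,
          Finsupp.single_eq_of_ne h1.symm, add_zero]
        ring

theorem derU_jet_mul (S R : MIdx D) (hR : R ≠ 0) (a : DiffPoly D U) :
    derU S (jet R * a) = (if S = R then a else 0) + jet R * derU S a := by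
  by_cases hS : S = 0
  · subst hS
    rw [if_neg (Ne.symm hR), zero_add]
    ext1 n
    rw [derU_zero_apply, jet, dif_neg hR, MvPowerSeries.X, MvPowerSeries.coeff_monomial_mul,
      MvPowerSeries.coeff_monomial_mul]
    split_ifs
    · rw [one_mul, one_mul, derU_zero_apply]
    · rw [map_zero]
  · rw [derU_apply hS, derU_apply hS, jet, dif_neg hR, Derivation.leibniz]
    by_cases h : S = R
    · subst h
      rw [if_pos rfl, MvPowerSeries.pderiv_X_self, smul_eq_mul, smul_eq_mul, mul_one, add_comm]
    · rw [if_neg h, MvPowerSeries.pderiv_X_of_ne fun h1 => h (congrArg Subtype.val h1).symm,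
        smul_eq_mul, smul_zero, add_zero, zero_add]

theorem jetDer_comm (S R : MIdx D) (f : Ahat D U) :
    jetDer S (jetDer R f) = jetDer R (jetDer S f) :=
  funext fun T => derU_comm S R (f T)

theorem jetDer_jetMul (S R : MIdx D) (hR : R ≠ 0) (f : Ahat D U) :
    jetDer S (jetMul R f) = (if S = R then f else 0) + jetMul R (jetDer S f) := by
  funext T
  refine (derU_jet_mul S R hR (f T)).trans ?_
  split_ifs <;> rfl

theorem jetDer_thetaMul (S R : MIdx D) (f : Ahat D U) :
    jetDer S (thetaMul R f) = thetaMul R (jetDer S f) := by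
  funext T
  change derU S (thetaMul R f T) = _
  rw [thetaMul_apply, thetaMul_apply]
  split_ifs
  · exact map_smul _ _ _
  · exact map_zero _

theorem jetDer_thetaDer (S R : MIdx D) (f : Ahat D U) :
    jetDer S (thetaDer R f) = thetaDer R (jetDer S f) := by
  funext T
  change derU S (thetaDer R f T) = _
  rw [thetaDer_apply, thetaDer_apply]
  split_ifs
  · exact map_zero _
  · exact map_smul _ _ _

theorem thetaMul_jetMul (S R : MIdx D) (f : Ahat D U) :
    thetaMul S (jetMul R f) = jetMul R (thetaMul S f) := by
  funext T
  change _ = jet R * thetaMul S f T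
  rw [thetaMul_apply, thetaMul_apply]
  split_ifs
  · exact (mul_smul_comm _ _ _).symm
  · exact (mul_zero _).symm

/-- An operator each of whose output coefficients depends on finitely many input coefficients. -/
def IsLocal (M : Ahat D U →ₗ[ℝ] Ahat D U) : Prop :=
  ∀ (T : Finset (MIdx D)) (n : {S : MIdx D // S ≠ 0} →₀ ℕ),
    ∃ K : Set (Finset (MIdx D) × ({S : MIdx D // S ≠ 0} →₀ ℕ)), K.Finite ∧
      ∀ f, (∀ c ∈ K, MvPowerSeries.coeff c.2 (f c.1) = 0) → MvPowerSeries.coeff n (M f T) = 0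

theorem IsLocal.comp {M N : Ahat D U →ₗ[ℝ] Ahat D U} (hM : IsLocal M) (hN : IsLocal N) :
    IsLocal (M ∘ₗ N) := by
  intro T n
  obtain ⟨K, hK, h⟩ := hM T n
  choose J hJ hJ' using fun c : Finset (MIdx D) × ({S : MIdx D // S ≠ 0} →₀ ℕ) => hN c.1 c.2
  refine ⟨⋃ c ∈ K, J c, hK.biUnion fun c _ => hJ c, fun f hf => ?_⟩
  exact h _ fun c hc => hJ' c f fun c' hc' => hf c' (Set.mem_biUnion hc hc')

theorem IsLocal.add {M N : Ahat D U →ₗ[ℝ] Ahat D U} (hM : IsLocal M) (hN : IsLocal N) :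
    IsLocal (M + N) := by
  intro T n
  obtain ⟨K, hK, h⟩ := hM T n
  obtain ⟨J, hJ, h'⟩ := hN T n
  refine ⟨K ∪ J, hK.union hJ, fun f hf => ?_⟩
  rw [LinearMap.add_apply, Pi.add_apply, map_add, h f fun c hc => hf c (Or.inl hc),
    h' f fun c hc => hf c (Or.inr hc), add_zero]

theorem coeff_smul_real (n : {S : MIdx D // S ≠ 0} →₀ ℕ) (c : ℝ) (a : DiffPoly D U) :
    MvPowerSeries.coeff n (c • a) = c • MvPowerSeries.coeff n a :=
  rfl

theorem isLocal_thetaMul (R : MIdx D) : IsLocal (thetaMul (U := U) R) := by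
  intro T n
  refine ⟨{(T.erase R, n)}, Set.finite_singleton _, fun f hf => ?_⟩
  have := hf _ rfl
  rw [thetaMul_apply]
  split_ifs
  · rw [coeff_smul_real, this, smul_zero]
  · exact map_zero _

theorem isLocal_thetaDer (R : MIdx D) : IsLocal (thetaDer (U := U) R) := by
  intro T n
  refine ⟨{(insert R T, n)}, Set.finite_singleton _, fun f hf => ?_⟩
  have := hf _ rfl
  rw [thetaDer_apply]
  split_ifs
  · exact map_zero _
  · rw [coeff_smul_real, this, smul_zero]

theorem isLocal_jetDer (R : MIdx D) : IsLocal (jetDer (U := U) R) := by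
  intro T n
  by_cases hR : R = 0
  · subst hR
    refine ⟨{(T, n)}, Set.finite_singleton _, fun f hf => ?_⟩
    have := hf _ rfl
    exact (derU_zero_apply (f T) n).trans (by rw [this, map_zero])
  · refine ⟨{(T, n + Finsupp.single ⟨R, hR⟩ 1)}, Set.finite_singleton _, fun f hf => ?_⟩
    have := hf _ rfl
    exact (coeff_derU hR (f T) n).trans (by rw [this, smul_zero])

theorem isLocal_jetMul (R : MIdx D) : IsLocal (jetMul (U := U) R) := by
  classical
  intro T n
  refine ⟨(fun c => (T, c.2)) '' (Finset.HasAntidiagonal.antidiagonal n :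
      Set (({S : MIdx D // S ≠ 0} →₀ ℕ) × ({S : MIdx D // S ≠ 0} →₀ ℕ))),
    (Finset.finite_toSet _).image _, fun f hf => ?_⟩
  change MvPowerSeries.coeff n (jet R * f T) = 0
  rw [MvPowerSeries.coeff_mul]
  refine Finset.sum_eq_zero fun c hc => ?_
  have := hf (T, c.2) ⟨c, hc, rfl⟩
  rw [this, mul_zero]

theorem LocallyFinite.comp {L : MIdx D → Ahat D U →ₗ[ℝ] Ahat D U} (hL : LocallyFinite L)
    {M : Ahat D U →ₗ[ℝ] Ahat D U} (hM : IsLocal M) : LocallyFinite fun S => M ∘ₗ L S := by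
  intro T n
  obtain ⟨K, hK, h⟩ := hM T n
  refine (hK.biUnion fun c _ => hL c.1 c.2).subset ?_
  rintro S ⟨f, hf⟩
  by_contra hS
  refine hf (h _ fun c hc => ?_)
  by_contra hc'
  exact hS (Set.mem_biUnion hc ⟨f, hc'⟩)

theorem isLocal_sumOp {L : MIdx D → Ahat D U →ₗ[ℝ] Ahat D U} (hL : LocallyFinite L)
    (h : ∀ S, IsLocal (L S)) : IsLocal (sumOp L hL) := by
  intro T n
  choose K hK hK' using fun S => h S T n
  refine ⟨⋃ S ∈ {S | ∃ f, MvPowerSeries.coeff n (L S f T) ≠ 0}, K S,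
    (hL T n).biUnion fun S _ => hK S, fun f hf => ?_⟩
  rw [coeff_sumOp]
  refine (finsum_congr fun S => ?_).trans finsum_zero
  by_contra hS
  exact hS (hK' S f fun c hc => hf c (Set.mem_biUnion (show S ∈ {S | ∃ f, _} from ⟨f, hS⟩) hc))

theorem IsLocal.comp_sumOp {L : MIdx D → Ahat D U →ₗ[ℝ] Ahat D U} (hL : LocallyFinite L)
    {M : Ahat D U →ₗ[ℝ] Ahat D U} (hM : IsLocal M) (f : Ahat D U) (T : Finset (MIdx D))
    (n : {S : MIdx D // S ≠ 0} →₀ ℕ) :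
    MvPowerSeries.coeff n (M (sumOp L hL f) T) =
      ∑ᶠ S, MvPowerSeries.coeff n (M (L S f) T) := by
  classical
  obtain ⟨K, hK, h⟩ := hM T n
  have hF := hK.biUnion fun c _ => hL c.1 c.2
  have hsum : ∀ c ∈ K, MvPowerSeries.coeff c.2 (sumOp L hL f c.1) =
      ∑ S ∈ hF.toFinset, MvPowerSeries.coeff c.2 (L S f c.1) := by
    intro c hc
    rw [coeff_sumOp]
    refine finsum_eq_sum_of_support_subset _ fun S hS => ?_
    exact hF.mem_toFinset.2 (Set.mem_biUnion hc ⟨f, hS⟩)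
  have h0 := h (sumOp L hL f - ∑ S ∈ hF.toFinset, L S f) fun c hc => by
    rw [Pi.sub_apply, map_sub, hsum c hc, Finset.sum_apply, map_sum, sub_self]
  rw [map_sub, Pi.sub_apply, map_sub, sub_eq_zero] at h0
  rw [h0, map_sum, Finset.sum_apply, map_sum]
  refine (finsum_eq_sum_of_support_subset _ fun S hS => ?_).symm
  refine hF.mem_toFinset.2 ?_
  by_contra hS'
  refine hS (h _ fun c hc => ?_)
  by_contra hc'
  exact hS' (Set.mem_biUnion hc ⟨f, hc'⟩)

theorem isLocal_Delta (k : Fin D) : IsLocal (Delta (U := U) k) :=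
  isLocal_sumOp _ fun S => (isLocal_thetaMul _).comp (isLocal_jetDer S)

theorem isLocal_partialX_term (i : Fin D) (S : MIdx D) :
    IsLocal (partialTerm (U := U) i S) :=
  ((isLocal_jetMul _).comp (isLocal_jetDer S)).add ((isLocal_thetaMul _).comp (isLocal_thetaDer S))

theorem deltaTerm_anticomm (k : Fin D) (S R : MIdx D) (f : Ahat D U) :
    deltaTerm k S (deltaTerm k R f) = -deltaTerm k R (deltaTerm k S f) := by
  change thetaMul (S + xi k) (jetDer S (thetaMul (R + xi k) (jetDer R f))) =
    -thetaMul (R + xi k) (jetDer R (thetaMul (S + xi k) (jetDer S f)))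
  rw [jetDer_thetaMul, jetDer_thetaMul, thetaMul_thetaMul, jetDer_comm]

theorem isLocal_deltaTerm (k : Fin D) (S : MIdx D) : IsLocal (deltaTerm (U := U) k S) :=
  (isLocal_thetaMul _).comp (isLocal_jetDer S)

theorem Delta_Delta (k : Fin D) (f : Ahat D U) : Delta k (Delta k f) = 0 := by
  have hanti : ∀ S : MIdx D, deltaTerm k S (Delta k f) = -Delta k (deltaTerm k S f) := by
    intro S
    funext T
    ext1 n
    refine ((isLocal_deltaTerm (U := U) k S).comp_sumOp (locallyFinite_Delta k) f T n).trans ?_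
    rw [Pi.neg_apply, map_neg, Delta, coeff_sumOp, ← finsum_neg_distrib]
    refine finsum_congr fun R => ?_
    rw [deltaTerm_anticomm, Pi.neg_apply, map_neg]
  have h : Delta k (Delta k f) = -Delta k (Delta k f) := by
    funext T
    ext1 n
    rw [Pi.neg_apply, map_neg]
    have h2 := (isLocal_Delta (U := U) k).comp_sumOp (locallyFinite_Delta k) f T n
    refine Eq.trans ?_ (congrArg Neg.neg h2).symm
    rw [← finsum_neg_distrib]
    conv_lhs => rw [Delta, coeff_sumOp]
    refine finsum_congr fun S => ?_
    exact (congrArg (fun g => MvPowerSeries.coeff n (g T)) (hanti S)).trans (map_neg _ _)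
  have h3 : (2 : ℝ) • Delta k (Delta k f) = 0 := by
    rw [two_smul]
    nth_rewrite 1 [h]
    exact neg_add_cancel _
  exact (smul_eq_zero.1 h3).resolve_left two_ne_zero

/-- The `S`-th term of the commutator of `Delta k` with the `R`-th term of `partialX j`. -/
theorem commutator_term (k j : Fin D) (S R : MIdx D) (f : Ahat D U) :
    deltaTerm k S (partialTerm j R f) = partialTerm j R (deltaTerm k S f) +
      ((if S = R + xi j then thetaMul (R + xi j + xi k) (jetDer R f) else 0) -
        (if S + xi k = R then thetaMul (R + xi j) (jetDer S f) else 0)) := by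
  have h1 : thetaMul (S + xi k) (jetDer S (jetMul (R + xi j) (jetDer R f))) =
      jetMul (R + xi j) (jetDer R (thetaMul (S + xi k) (jetDer S f))) +
      (if S = R + xi j then thetaMul (R + xi j + xi k) (jetDer R f) else 0) := by
    rw [jetDer_jetMul _ _ (add_xi_ne_zero R j), map_add, thetaMul_jetMul, jetDer_thetaMul,
      jetDer_comm, add_comm]
    congr 1
    split_ifs with h
    · rw [h]
    · exact map_zero _
  have h2 : thetaMul (S + xi k) (jetDer S (thetaMul (R + xi j) (thetaDer R f))) =
      thetaMul (R + xi j) (thetaDer R (thetaMul (S + xi k) (jetDer S f))) -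
      (if S + xi k = R then thetaMul (R + xi j) (jetDer S f) else 0) := by
    rw [jetDer_thetaMul, jetDer_thetaDer, thetaMul_thetaMul, thetaMul_thetaDer, map_sub, neg_sub]
    congr 1
    split_ifs
    · rfl
    · exact map_zero _
  change thetaMul (S + xi k) (jetDer S (jetMul (R + xi j) (jetDer R f) +
      thetaMul (R + xi j) (thetaDer R f))) =
    (jetMul (R + xi j) (jetDer R (thetaMul (S + xi k) (jetDer S f))) +
      thetaMul (R + xi j) (thetaDer R (thetaMul (S + xi k) (jetDer S f)))) + _
  rw [map_add, map_add, h1, h2]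
  abel

theorem finsum_shift {M : Type*} [AddCommMonoid M] (k : Fin D) (g : MIdx D → M)
    (hg : (Function.support g).Finite) :
    (Function.support fun R => ∑ᶠ S, if S + xi k = R then g S else 0).Finite ∧
      ∑ᶠ R, (∑ᶠ S, if S + xi k = R then g S else 0) = ∑ᶠ S, g S := by
  have hval : ∀ S, (∑ᶠ S', if S' + xi k = S + xi k then g S' else 0) = g S := fun S => by
    rw [finsum_eq_single _ S fun S' hS' => if_neg fun h => hS' (add_right_cancel h), if_pos rfl]
  have hsupp : ∀ R, (∑ᶠ S, if S + xi k = R then g S else 0) ≠ 0 → ∃ S, S + xi k = R := by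
    intro R hR
    by_contra h
    push Not at h
    exact hR ((finsum_congr fun S => if_neg (h S)).trans finsum_zero)
  constructor
  · refine (hg.image fun S => S + xi k).subset fun R hR => ?_
    obtain ⟨S, rfl⟩ := hsupp R hR
    exact ⟨S, fun h => hR ((hval S).trans h), rfl⟩
  · have h1 := finsum_mem_inter_support_eq' (fun R => ∑ᶠ S, if S + xi k = R then g S else 0)
      Set.univ (Set.range fun S : MIdx D => S + xi k) fun R hR => by
        simpa using hsupp R hR
    rw [finsum_mem_univ] at h1
    rw [h1, finsum_mem_range fun _ _ h => add_right_cancel h]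
    exact finsum_congr hval

theorem Delta_partialX (k j : Fin D) (f : Ahat D U) :
    Delta k (partialX j f) = partialX j (Delta k f) := by
  classical
  funext T
  ext1 n
  set g : MIdx D → SmoothFn U := fun R =>
    MvPowerSeries.coeff n (thetaMul (R + xi j + xi k) (jetDer R f) T) with hg
  have hgfin : (Function.support g).Finite := by
    refine (finite_add_xi j (finite_add_xi k T.finite_toSet)).subset fun R hR => ?_
    by_contra h
    refine hR ?_
    rw [hg]
    dsimp only
    rw [thetaMul_eq_zero _ (by simpa using h), map_zero]
  -- the commutator of `Delta k` with the `R`-th term of `partialX j`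
  have hR : ∀ R : MIdx D,
      MvPowerSeries.coeff n (Delta k (partialTerm j R f) T) =
      MvPowerSeries.coeff n (partialTerm j R (Delta k f) T) +
      (g R - ∑ᶠ S, if S + xi k = R then g S else 0) := by
    intro R
    have h1 := (isLocal_partialX_term (U := U) j R).comp_sumOp (locallyFinite_Delta k) f T n
    have h1' : (Function.support fun S => MvPowerSeries.coeff n
        (partialTerm j R (deltaTerm k S f) T)).Finite :=
      ((locallyFinite_Delta (U := U) k).comp (isLocal_partialX_term j R)).finite f T n
    refine Eq.trans ?_ (congrArg (· + _) h1.symm)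
    have e1 : (Function.support fun S : MIdx D => if S = R + xi j then g R else 0).Finite :=
      (Set.finite_singleton (R + xi j)).subset fun S hS => by
        by_contra h
        exact hS (if_neg h)
    have e2 : (Function.support fun S : MIdx D => if S + xi k = R then g S else 0).Finite :=
      (finite_add_xi k (Set.finite_singleton R)).subset fun S hS => by
        by_contra h
        exact hS (if_neg h)
    have e3 : g R = ∑ᶠ S : MIdx D, if S = R + xi j then g R else 0 := by
      rw [finsum_eq_single _ (R + xi j) fun S hS => if_neg hS, if_pos rfl]
    rw [e3, ← finsum_sub_distrib e1 e2, ← finsum_add_distrib h1'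
      ((e1.union e2).subset (Function.support_sub _ _)), Delta, coeff_sumOp]
    refine finsum_congr fun S => ?_
    have h2 := congrArg (fun g => MvPowerSeries.coeff n (g T)) (commutator_term k j S R f)
    refine h2.trans ?_
    rw [Pi.add_apply, Pi.sub_apply, map_add, map_sub]
    refine congrArg₂ _ rfl (congrArg₂ _ ?_ ?_)
    · split_ifs
      · rfl
      · exact map_zero _
    · split_ifs with h
      · rw [← h, hg]
        dsimp only
        rw [add_right_comm]
      · exact map_zero _
  have h1 := (isLocal_Delta (U := U) k).comp_sumOp (locallyFinite_partialX j) f T n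
  refine h1.trans ((finsum_congr hR).trans ?_)
  obtain ⟨h2, h3⟩ := finsum_shift k g hgfin
  rw [finsum_add_distrib ((locallyFinite_partialX j).finite (Delta k f) T n)
    ((hgfin.union h2).subset (Function.support_sub _ _)), finsum_sub_distrib hgfin h2, h3,
    sub_self, add_zero]
  rfl

/-! ### Bidegrees, the spaces `F̂_i` and their cohomology -/

/-- The bihomogeneous component `Â^p_d`: super degree `p` in the `θ^S`, and standard degree `d`
where `deg u^S = deg θ^S = |S|`. It vanishes if `p < 0` or `d < 0`. -/
def homog (D : ℕ) (U : TopologicalSpace.Opens ℝ) (p d : ℤ) : Submodule ℝ (Ahat D U) where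
  carrier := {f | ∀ (T : Finset (MIdx D)) (n : {S : MIdx D // S ≠ 0} →₀ ℕ),
    MvPowerSeries.coeff n (f T) ≠ 0 →
      (T.card : ℤ) = p ∧ ((n.sum fun S m => m * len S.1) + ∑ S ∈ T, len S : ℕ) = d}
  zero_mem' := fun T n h => absurd (map_zero _) h
  add_mem' := fun {f g} hf hg T n h => by
    by_cases h1 : MvPowerSeries.coeff n (f T) = 0
    · refine hg T n fun h2 => h ?_
      rw [Pi.add_apply, map_add, h1, h2, add_zero]
    · exact hf T n h1
  smul_mem' := fun c f hf T n h => hf T n fun h1 => h (by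
    rw [Pi.smul_apply, coeff_smul_real, h1, smul_zero])

variable (U) in
/-- The subspace `∂_{x^1} Â + ⋯ + ∂_{x^i} Â`. (The index `j : Fin D` is zero-based.) -/
def divergences (i : ℕ) : Submodule ℝ (Ahat D U) :=
  ⨆ (j : Fin D) (_ : (j : ℕ) < i), LinearMap.range (partialX (U := U) j)

variable (D U) in
/-- The space `F̂_i = Â / (∂_{x^1} Â + ⋯ + ∂_{x^i} Â)`. -/
abbrev Fhat (i : ℕ) := Ahat D U ⧸ divergences (D := D) U i

theorem divergences_le_comap (k : Fin D) (i : ℕ) :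
    divergences U i ≤ (divergences U i).comap (Delta k) := by
  refine iSup₂_le fun j hj => ?_
  rintro _ ⟨f, rfl⟩
  rw [Submodule.mem_comap, Delta_partialX]
  exact Submodule.mem_iSup_of_mem j (Submodule.mem_iSup_of_mem hj ⟨_, rfl⟩)

variable (U) in
/-- The differential induced by `Delta k` on `F̂_i`. -/
def dF (k : Fin D) (i : ℕ) : Fhat D U i →ₗ[ℝ] Fhat D U i :=
  (divergences U i).mapQ (divergences U i) (Delta k) (divergences_le_comap k i)

theorem dF_dF (k : Fin D) (i : ℕ) (x : Fhat D U i) : dF U k i (dF U k i x) = 0 := by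
  obtain ⟨f, rfl⟩ := Submodule.mkQ_surjective _ x
  exact congrArg (Submodule.mkQ _) (Delta_Delta k f) |>.trans (map_zero _)

variable (D U) in
/-- The bihomogeneous component `(F̂_i)^p_d`. -/
def homogF (i : ℕ) (p d : ℤ) : Submodule ℝ (Fhat D U i) :=
  (homog D U p d).map (divergences U i).mkQ

variable (U) in
/-- The cocycles of bidegree `(p, d)` in `F̂_i`. -/
def cocycles (k : Fin D) (i : ℕ) (p d : ℤ) : Submodule ℝ (Fhat D U i) :=
  homogF D U i p d ⊓ LinearMap.ker (dF U k i)

variable (U) in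
/-- The coboundaries of bidegree `(p, d)` in `F̂_i`; the differential has bidegree `(1, 1)`. -/
def coboundaries (k : Fin D) (i : ℕ) (p d : ℤ) : Submodule ℝ (Fhat D U i) :=
  (homogF D U i (p - 1) (d - 1)).map (dF U k i)

variable (U) in
/-- The cohomology group `H^p_d(F̂_i)`. -/
abbrev Cohomology (k : Fin D) (i : ℕ) (p d : ℤ) :=
  cocycles U k i p d ⧸ (coboundaries U k i p d).submoduleOf (cocycles U k i p d)

/-! ### The polynomial ring `Θ` -/

/-- The monomial `θ^{S_1} ⋯ θ^{S_p}`, for `T = {S_1 < ⋯ < S_p}`. -/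
def thetaMonomial (T : Finset (MIdx D)) : Ahat D U := Pi.single T 1

variable (U) in
/-- The space `Θ = ℝ[θ^S, S ∈ Z_k]` of polynomials with real coefficients in the `θ^S` with
`s_k = 0`, as a subspace of `Â`. -/
def Theta (k : Fin D) : Submodule ℝ (Ahat D U) :=
  Submodule.span ℝ (thetaMonomial '' {T : Finset (MIdx D) | ∀ S ∈ T, S k = 0})

variable (U) in
/-- The component `Θ^p_d` of `Θ`. -/
def ThetaHomog (k : Fin D) (p d : ℤ) : Submodule ℝ (Ahat D U) :=
  Theta U k ⊓ homog D U p d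

variable (U) in
/-- The subspace `∂_{x^1} Θ + ⋯ + ∂_{x^i} Θ`, as a subspace of `Â`. -/
def thetaDivergences (k : Fin D) (i : ℕ) : Submodule ℝ (Ahat D U) :=
  ⨆ (j : Fin D) (_ : (j : ℕ) < i), (Theta U k).map (partialX j)

variable (U) in
/-- The subspace `∂_{x^1} Θ^p_{d-1} + ⋯ + ∂_{x^i} Θ^p_{d-1}`, as a subspace of `Â`. -/
def thetaDivergencesHomog (k : Fin D) (i : ℕ) (p d : ℤ) : Submodule ℝ (Ahat D U) :=
  ⨆ (j : Fin D) (_ : (j : ℕ) < i), (ThetaHomog U k p (d - 1)).map (partialX j)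

variable (U) in
/-- The quotient `Θ / (∂_{x^1} Θ + ⋯ + ∂_{x^i} Θ)`. -/
abbrev ThetaQuot (k : Fin D) (i : ℕ) :=
  Theta U k ⧸ (thetaDivergences U k i).submoduleOf (Theta U k)

variable (U) in
/-- The quotient `Θ^p_d / (∂_{x^1} Θ^p_{d-1} + ⋯ + ∂_{x^i} Θ^p_{d-1})`. -/
abbrev ThetaQuotHomog (k : Fin D) (i : ℕ) (p d : ℤ) :=
  ThetaHomog U k p d ⧸ (thetaDivergencesHomog U k i p d).submoduleOf (ThetaHomog U k p d)

theorem derU_one (S : MIdx D) : derU S (1 : DiffPoly D U) = 0 := by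
  by_cases hS : S = 0
  · subst hS
    ext1 n
    rw [derU_zero_apply, map_zero]
    ext x
    change dUFun _ x = (0 : SmoothFn U) x
    rw [dUFun_apply]
    classical
    have h : ∃ c : ℝ, ∀ y : U, (MvPowerSeries.coeff n (1 : DiffPoly D U)) y = c := by
      rw [MvPowerSeries.coeff_one]
      split_ifs
      · exact ⟨1, fun y => rfl⟩
      · exact ⟨0, fun y => rfl⟩
    obtain ⟨c, hc⟩ := h
    rw [(extendZero_eventuallyEq x (g := fun _ => c) hc).deriv_eq, deriv_const]
    rfl
  · rw [derU_apply hS, Derivation.map_one_eq_zero]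

theorem Delta_of_mem_Theta (k : Fin D) {a : Ahat D U} (ha : a ∈ Theta U k) : Delta k a = 0 := by
  have h : Theta U k ≤ LinearMap.ker (Delta k) := by
    refine Submodule.span_le.2 ?_
    rintro _ ⟨T, -, rfl⟩
    have h0 : ∀ S : MIdx D, jetDer S (thetaMonomial T : Ahat D U) = 0 := by
      intro S
      funext T'
      change derU S ((Pi.single T 1 : Ahat D U) T') = 0
      by_cases hT : T' = T
      · subst hT
        rw [Pi.single_eq_same, derU_one]
      · rw [Pi.single_eq_of_ne hT, map_zero]
    refine LinearMap.mem_ker.2 ?_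
    funext T'
    ext1 n
    rw [Delta, coeff_sumOp]
    refine (finsum_congr fun S => ?_).trans finsum_zero
    rw [deltaTerm, LinearMap.comp_apply, h0, map_zero]
    exact map_zero _
  exact h ha

theorem mkQ_mem_cocycles (k : Fin D) (i : ℕ) (p d : ℤ) (a : ThetaHomog U k p d) :
    (divergences U i).mkQ a ∈ cocycles U k i p d := by
  refine ⟨Submodule.mem_map_of_mem a.2.2, LinearMap.mem_ker.2 ?_⟩
  exact (congrArg (divergences U i).mkQ (Delta_of_mem_Theta k a.2.1)).trans (map_zero _)

variable (U) in
/-- The natural map `Θ^p_d → H^p_d(F̂_i)`, sending an element to the class it represents. -/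
def thetaClass (k : Fin D) (i : ℕ) (p d : ℤ) :
    ThetaHomog U k p d →ₗ[ℝ] Cohomology U k i p d :=
  Submodule.mkQ _ ∘ₗ
    (((divergences U i).mkQ ∘ₗ (ThetaHomog U k p d).subtype).codRestrict (cocycles U k i p d)
      (mkQ_mem_cocycles k i p d))

variable (U) in
/-- The natural map `Θ → Θ / (∂_{x^1} Θ + ⋯ + ∂_{x^i} Θ)`, restricted to `Θ^p_d`. -/
def thetaQuotMk (k : Fin D) (i : ℕ) (p d : ℤ) : ThetaHomog U k p d →ₗ[ℝ] ThetaQuot U k i :=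
  Submodule.mkQ _ ∘ₗ Submodule.inclusion inf_le_left

end DNBracket

end

end

/-! The proof is a Poincaré-lemma homotopy that respects the total derivatives in every direction
other than the distinguished one `k`. Fix `u₀ ∈ U`, write `v^0 = u - u₀` and `v^S = u^S` for `S ≠
0`, and let `iota` be the contraction `∑ v^S ∂/∂θ^{S+ξ_k}`. The anticommutator `E` of `Delta k` and
`iota` (`eulerOp`) is diagonal on monomials: on a coefficient of weight `m`, the number of factors
`u^S` and `θ^{S+ξ_k}`, it acts as `(u - u₀) d/du + m` (`coeff_eulerOp`).

Since `U` is an interval, this ordinary differential operator is bijective on `C^∞(U)` for `m ≥ 1`.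
For `m = 0` its kernel is the constants and its image the functions vanishing at `u₀`. Hence the
whole space splits as kernel plus image of `E`, with projection `P` onto the kernel (`eulerProj`).
The range of `P` consists of possibly infinite real combinations of monomials in the `θ^S` with `s_k
= 0`. In a fixed bidegree there are only finitely many such monomials, and the range becomes the
corresponding component of `Θ`.

The contraction commutes with `∂_{x^j}` for `j ≠ k` (`iota_partialX`), so `E` and `P` do too;
moreover `P` kills the image of `Delta k`, while `Delta k` and `iota` kill the range of `P`. If
`Delta k f` is a divergence and `E g = f - P f`, then `f - P f = Δ(ι g) + ι(Δ g)`, and the last term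
is again a divergence (`exists_primitive`). So every class is represented by `P f ∈ Θ`. Conversely,
if `a ∈ Θ` equals `Δ g` up to a divergence, applying `P` removes `Δ g` and exhibits `a` as a
divergence inside `Θ`. The ungraded statement follows because `Θ` and its divergences decompose by
bidegree. -/

noncomputable section

namespace DNBracket

/-! ### Radial averages of smooth functions -/

/-- The average `∫₀¹ t^m g(u₀ + t (u - u₀)) dt` of `g` over the segment from `u₀` to `u`. -/
def radialAverage (u₀ : ℝ) (m : ℕ) (g : ℝ → ℝ) (u : ℝ) : ℝ :=
  ∫ t in (0 : ℝ)..1, t ^ m * g (u₀ + t * (u - u₀))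

theorem segment_mem {U : Set ℝ} {u₀ u t : ℝ} (hc : Convex ℝ U) (h₀ : u₀ ∈ U) (hu : u ∈ U)
    (ht : t ∈ Set.Icc (0 : ℝ) 1) : u₀ + t * (u - u₀) ∈ U := by
  have := hc.add_smul_sub_mem h₀ hu ht
  simpa using this

theorem continuousOn_radial {U : Set ℝ} {u₀ u : ℝ} (hc : Convex ℝ U) (h₀ : u₀ ∈ U) (hu : u ∈ U)
    (m : ℕ) {g : ℝ → ℝ} (hg : ContinuousOn g U) :
    ContinuousOn (fun t : ℝ => t ^ m * g (u₀ + t * (u - u₀))) (Set.Icc 0 1) :=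
  (by fun_prop : Continuous fun t : ℝ => t ^ m).continuousOn.mul
    (hg.comp (by fun_prop) fun _ ht => segment_mem hc h₀ hu ht)

/-- Differentiation under the integral sign. The chain rule produces one more factor `t`, which is
why the exponent rises to `m + 1`. -/
theorem hasDerivAt_radialAverage {U : Set ℝ} (hU : IsOpen U) (hc : Convex ℝ U) {u₀ u : ℝ}
    (h₀ : u₀ ∈ U) (hu : u ∈ U) (m : ℕ) {g : ℝ → ℝ} (hg : ContDiffOn ℝ 1 g U) :
    HasDerivAt (radialAverage u₀ m g) (radialAverage u₀ (m + 1) (deriv g) u) u := by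
  have hg' : ContinuousOn (deriv g) U := hg.continuousOn_deriv_of_isOpen hU le_rfl
  obtain ⟨ε, hε, hεU⟩ := Metric.isOpen_iff.1 hU u hu
  have hsub : Metric.closedBall u (ε / 2) ⊆ U :=
    (Metric.closedBall_subset_ball (by linarith)).trans hεU
  -- A constant dominating bound: the segments from `u₀` to a small closed ball around `u` sweep out
  -- a compact part of `U`.
  obtain ⟨M, hM⟩ := ((isCompact_Icc (a := (0 : ℝ)) (b := 1)).prod
    (isCompact_closedBall u (ε / 2))).exists_bound_of_continuousOn
    (f := fun q : ℝ × ℝ => deriv g (u₀ + q.1 * (q.2 - u₀)))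
    (hg'.comp (by fun_prop) fun q hq => segment_mem hc h₀ (hsub hq.2) hq.1)
  have hI : Set.uIoc (0 : ℝ) 1 ⊆ Set.Icc 0 1 := by
    rw [Set.uIoc_of_le zero_le_one]
    exact Set.Ioc_subset_Icc_self
  have hmeas : ∀ {x : ℝ} (n : ℕ) {f : ℝ → ℝ}, x ∈ U → ContinuousOn f U →
      MeasureTheory.AEStronglyMeasurable (fun t : ℝ => t ^ n * f (u₀ + t * (x - u₀)))
        (MeasureTheory.volume.restrict (Set.uIoc 0 1)) := fun n f hx hf =>
    ((continuousOn_radial hc h₀ hx n hf).mono hI).aestronglyMeasurable measurableSet_uIoc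
  refine (intervalIntegral.hasDerivAt_integral_of_dominated_loc_of_deriv_le
    (F := fun x t => t ^ m * g (u₀ + t * (x - u₀)))
    (F' := fun x t => t ^ (m + 1) * deriv g (u₀ + t * (x - u₀)))
    (bound := fun _ => M) (Metric.closedBall_mem_nhds u (half_pos hε)) ?_ ?_ ?_ ?_ ?_ ?_).2
  · filter_upwards [hU.mem_nhds hu] with x hx
    exact hmeas m hx hg.continuousOn
  · refine ContinuousOn.intervalIntegrable ?_
    rw [Set.uIcc_of_le zero_le_one]
    exact continuousOn_radial hc h₀ hu m hg.continuousOn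
  · exact hmeas (m + 1) hu hg'
  · refine Filter.Eventually.of_forall fun t ht x hx => ?_
    have ht' := hI ht
    have h1 := hM (t, x) ⟨ht', hx⟩
    rw [norm_mul, norm_pow, Real.norm_of_nonneg ht'.1]
    calc t ^ (m + 1) * ‖deriv g (u₀ + t * (x - u₀))‖
        ≤ 1 * ‖deriv g (u₀ + t * (x - u₀))‖ :=
          mul_le_mul_of_nonneg_right (pow_le_one₀ ht'.1 ht'.2) (norm_nonneg _)
      _ ≤ M := by rw [one_mul]; exact h1
  · exact intervalIntegrable_const
  · refine Filter.Eventually.of_forall fun t ht x hx => ?_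
    have hx' := segment_mem hc h₀ (hsub hx) (hI ht)
    have h1 : HasDerivAt g (deriv g (u₀ + t * (x - u₀))) (u₀ + t * (x - u₀)) :=
      ((hg.differentiableOn one_ne_zero).differentiableAt (hU.mem_nhds hx')).hasDerivAt
    have h2 : HasDerivAt (fun x : ℝ => u₀ + t * (x - u₀)) t x := by
      simpa using (((hasDerivAt_id x).sub_const u₀).const_mul t).const_add u₀
    have h3 := (h1.comp x h2).const_mul (t ^ m)
    exact h3.congr_deriv (by rw [pow_succ, mul_assoc, mul_comm t (deriv g _)])

/-- The derivative of a radial average is again a radial average, of `deriv g` with exponent `m +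
1`; hence the induction over all `m` and `g` at once. -/
theorem contDiffOn_radialAverage {U : Set ℝ} (hU : IsOpen U) (hc : Convex ℝ U) {u₀ : ℝ}
    (h₀ : u₀ ∈ U) (m : ℕ) {g : ℝ → ℝ} (hg : ContDiffOn ℝ ∞ g U) :
    ContDiffOn ℝ ∞ (radialAverage u₀ m g) U := by
  refine contDiffOn_infty.2 fun n => ?_
  induction n generalizing m g with
  | zero =>
    exact contDiffOn_zero.2 fun u hu => (hasDerivAt_radialAverage hU hc h₀ hu m
      (hg.of_le (by norm_num))).continuousAt.continuousWithinAt
  | succ n ih =>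
    have hd : ∀ u ∈ U, HasDerivAt (radialAverage u₀ m g)
        (radialAverage u₀ (m + 1) (deriv g) u) u := fun u hu =>
      hasDerivAt_radialAverage hU hc h₀ hu m (hg.of_le (by norm_num))
    push_cast
    refine (contDiffOn_succ_iff_deriv_of_isOpen hU).2
      ⟨fun u hu => (hd u hu).differentiableAt.differentiableWithinAt, by simp, ?_⟩
    exact (ih (m + 1) (hg.deriv_of_isOpen hU (by norm_num))).congr fun u hu => (hd u hu).deriv

/-- Integrate the `t`-derivative of `t^(m+1) g(u₀ + t (u - u₀))` over `[0, 1]`. This makes the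
radial average a solution of `(u - u₀) G' + (m + 1) G = g`. -/
theorem radialAverage_ode {U : Set ℝ} (hU : IsOpen U) (hc : Convex ℝ U) {u₀ u : ℝ}
    (h₀ : u₀ ∈ U) (hu : u ∈ U) (m : ℕ) {g : ℝ → ℝ} (hg : ContDiffOn ℝ 1 g U) :
    (u - u₀) * radialAverage u₀ (m + 1) (deriv g) u + (m + 1) * radialAverage u₀ m g u = g u := by
  have hg' : ContinuousOn (deriv g) U := hg.continuousOn_deriv_of_isOpen hU le_rfl
  have hi : ∀ (n : ℕ) {f : ℝ → ℝ}, ContinuousOn f U → IntervalIntegrable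
      (fun t : ℝ => t ^ n * f (u₀ + t * (u - u₀))) MeasureTheory.volume 0 1 := by
    intro n f hf
    refine ContinuousOn.intervalIntegrable ?_
    rw [Set.uIcc_of_le zero_le_one]
    exact continuousOn_radial hc h₀ hu n hf
  have h1 : ∫ t in (0 : ℝ)..1, ((u - u₀) * (t ^ (m + 1) * deriv g (u₀ + t * (u - u₀))) +
      (m + 1) * (t ^ m * g (u₀ + t * (u - u₀)))) =
      1 ^ (m + 1) * g (u₀ + 1 * (u - u₀)) - 0 ^ (m + 1) * g (u₀ + 0 * (u - u₀)) := by
    refine intervalIntegral.integral_eq_sub_of_hasDerivAt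
      (f := fun t => t ^ (m + 1) * g (u₀ + t * (u - u₀))) (fun t ht => ?_)
      (((hi _ hg').const_mul _).add ((hi _ hg.continuousOn).const_mul _))
    rw [Set.uIcc_of_le zero_le_one] at ht
    have hx := segment_mem hc h₀ hu ht
    have h1 : HasDerivAt g (deriv g (u₀ + t * (u - u₀))) (u₀ + t * (u - u₀)) :=
      ((hg.differentiableOn one_ne_zero).differentiableAt (hU.mem_nhds hx)).hasDerivAt
    have h2 : HasDerivAt (fun t : ℝ => u₀ + t * (u - u₀)) (u - u₀) t := by
      simpa using ((hasDerivAt_id t).mul_const (u - u₀)).const_add u₀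
    have h3 := (hasDerivAt_pow (m + 1) t).mul (h1.comp t h2)
    refine h3.congr_deriv ?_
    rw [add_tsub_cancel_right, Function.comp_apply]
    push_cast
    ring
  rw [intervalIntegral.integral_add ((hi _ hg').const_mul _) ((hi _ hg.continuousOn).const_mul _),
    intervalIntegral.integral_const_mul, intervalIntegral.integral_const_mul] at h1
  rw [radialAverage, radialAverage, h1]
  simp

/-! ### The Euler operator on smooth functions -/

variable {D : ℕ} {U : TopologicalSpace.Opens ℝ}

theorem contDiffOn_extendZero (f : SmoothFn U) : ContDiffOn ℝ ∞ (extendZero f) U := fun x hx =>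
  (contDiffAt_extendZero f ⟨x, hx⟩).contDiffWithinAt

theorem differentiableAt_extendZero (f : SmoothFn U) (x : U) :
    DifferentiableAt ℝ (extendZero f) (x : ℝ) :=
  (contDiffAt_extendZero f x).differentiableAt (by norm_num)

theorem exists_smoothFn {g : ℝ → ℝ} (hg : ContDiffOn ℝ ∞ g U) :
    ∃ G : SmoothFn U, ∀ x : U, G x = g x :=
  ⟨⟨fun x : U => g x, fun x => contMDiffAt_subtype_iff.mpr
    ((hg x x.2).contDiffAt (U.isOpen.mem_nhds x.2)).contMDiffAt⟩, fun _ => rfl⟩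

theorem dU_apply (f : SmoothFn U) (x : U) : dU U f x = deriv (extendZero f) (x : ℝ) :=
  rfl

theorem dU_eq_deriv {f : SmoothFn U} {g : ℝ → ℝ} (h : ∀ y : U, f y = g y) (x : U) :
    dU U f x = deriv g x := by
  rw [dU_apply, (extendZero_eventuallyEq x h).deriv_eq]

theorem dU_mul (f g : SmoothFn U) : dU U (f * g) = dU U f * g + f * dU U g := by
  ext x
  rw [dU_eq_deriv (f := f * g) (g := extendZero f * extendZero g)
    (fun y => by simp [extendZero_apply]), deriv_mul (differentiableAt_extendZero f x)
    (differentiableAt_extendZero g x), extendZero_apply, extendZero_apply]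
  rfl

theorem dU_smul_one (c : ℝ) : dU U (c • (1 : SmoothFn U)) = 0 := by
  ext x
  rw [dU_eq_deriv (f := c • (1 : SmoothFn U)) (g := fun _ => c) (fun y => by simp), deriv_const]
  rfl

theorem dU_coordU : dU U (coordU U) = 1 := by
  ext x
  rw [dU_eq_deriv (f := coordU U) (g := id) (fun y => rfl), deriv_id]
  rfl

/-- The coordinate `u - u₀`. -/
def centered (u₀ : U) : SmoothFn U := coordU U - (u₀ : ℝ) • 1

theorem centered_apply (u₀ x : U) : centered u₀ x = (x : ℝ) - u₀ := by
  change (x : ℝ) - ((u₀ : ℝ) • (1 : SmoothFn U)) x = _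
  simp

theorem dU_centered_mul (u₀ : U) (f : SmoothFn U) :
    dU U (centered u₀ * f) = f + centered u₀ * dU U f := by
  rw [dU_mul, centered, map_sub, dU_smul_one, dU_coordU, sub_zero, one_mul]

theorem eq_smul_one_of_dU_eq_zero (hU : IsConnected (U : Set ℝ)) (u₀ : U) {f : SmoothFn U}
    (h : dU U f = 0) : f = f u₀ • 1 := by
  ext x
  have h1 := U.isOpen.is_const_of_deriv_eq_zero hU.isPreconnected
    ((contDiffOn_extendZero f).differentiableOn (by norm_num))
    (fun y hy => DFunLike.congr_fun h ⟨y, hy⟩) x.2 u₀.2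
  rw [extendZero_apply, extendZero_apply] at h1
  simp [h1]

/-- The operator `(u - u₀) d/du + m`. -/
def euler (u₀ : U) (m : ℕ) (f : SmoothFn U) : SmoothFn U :=
  centered u₀ * dU U f + (m : ℝ) • f

theorem euler_apply_center (u₀ : U) (m : ℕ) (f : SmoothFn U) : euler u₀ m f u₀ = m * f u₀ := by
  simp [euler, centered_apply]

theorem exists_euler_succ (hU : IsConnected (U : Set ℝ)) (u₀ : U) (m : ℕ) (g : SmoothFn U) :
    ∃ G, euler u₀ (m + 1) G = g := by
  have hc : Convex ℝ (U : Set ℝ) := hU.isPreconnected.ordConnected.convex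
  have hg := contDiffOn_extendZero g
  have hg1 : ContDiffOn ℝ 1 (extendZero g) U := hg.of_le (by norm_num)
  obtain ⟨G, hG⟩ := exists_smoothFn (contDiffOn_radialAverage U.isOpen hc u₀.2 m hg)
  refine ⟨G, ?_⟩
  ext x
  have h1 := radialAverage_ode U.isOpen hc u₀.2 x.2 m hg1
  rw [extendZero_apply] at h1
  rw [← h1, ← hG, ← (hasDerivAt_radialAverage U.isOpen hc u₀.2 x.2 m hg1).deriv,
    ← dU_eq_deriv hG]
  simp [euler, centered_apply]

/-- The power of `u - u₀` is an integrating factor for the Euler operator. -/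
theorem dU_centered_pow_mul (u₀ : U) (m : ℕ) (f : SmoothFn U) :
    dU U (centered u₀ ^ (m + 1) * f) = centered u₀ ^ m * euler u₀ (m + 1) f := by
  induction m with
  | zero => rw [zero_add, pow_one, dU_centered_mul, euler]; simp [add_comm]
  | succ m ih =>
    rw [pow_succ', mul_assoc, dU_centered_mul, ih, euler, euler, pow_succ']
    push_cast
    simp only [mul_add, add_smul, mul_smul_comm, one_smul]
    ring_nf

/-- By the integrating factor, `(u - u₀)^(m+1) f` is constant, and it vanishes at `u₀`; so `f`
vanishes away from `u₀`. At `u₀` the equation itself reads `(m + 1) f(u₀) = 0`. -/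
theorem eq_zero_of_euler_succ (hU : IsConnected (U : Set ℝ)) {u₀ : U} {m : ℕ} {f : SmoothFn U}
    (h : euler u₀ (m + 1) f = 0) : f = 0 := by
  have h1 := dU_centered_pow_mul u₀ m f
  rw [h, mul_zero] at h1
  have h2 := eq_smul_one_of_dU_eq_zero hU u₀ h1
  have h3 : ∀ x : U, ((x : ℝ) - u₀) ^ (m + 1) * f x = 0 := fun x => by
    have h4 := DFunLike.congr_fun h2 x
    have hp : ∀ y : U, (centered u₀ ^ (m + 1)) y = ((y : ℝ) - u₀) ^ (m + 1) := fun y => by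
      rw [← centered_apply]
      exact congrFun (ContMDiffMap.coe_pow _ _) y
    simp only [ContMDiffMap.coe_mul, ContMDiffMap.coe_smul, Pi.mul_apply, Pi.smul_apply, hp,
      sub_self] at h4
    simpa using h4
  ext x
  by_cases hx : x = u₀
  · have h5 := euler_apply_center u₀ (m + 1) f
    rw [h] at h5
    subst hx
    have : ((m : ℝ) + 1) * f x = 0 := by simpa using h5.symm
    exact (mul_eq_zero.1 this).resolve_left (by positivity)
  · exact (mul_eq_zero.1 (h3 x)).resolve_left
      (pow_ne_zero _ (sub_ne_zero.2 fun h => hx (Subtype.ext h)))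

/-- Differentiating `(u - u₀) f' = 0` gives the Euler equation of weight one for `f'`, which has
only the zero solution. -/
theorem dU_eq_zero_of_euler_zero (hU : IsConnected (U : Set ℝ)) {u₀ : U} {f : SmoothFn U}
    (h : euler u₀ 0 f = 0) : dU U f = 0 := by
  have h1 : centered u₀ * dU U f = 0 := by simpa [euler] using h
  refine eq_zero_of_euler_succ hU (u₀ := u₀) (m := 0) ?_
  have h2 := dU_centered_pow_mul u₀ 0 (dU U f)
  rw [zero_add, pow_one, h1, map_zero, pow_zero, one_mul] at h2
  exact h2.symm

/-- Hadamard's lemma used twice: `q` satisfies `(u - u₀) q = g`, as both sides have the same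
derivative and vanish at `u₀`, and `r` satisfies `((u - u₀) r)' = q`. Then `(u - u₀) r` is a
solution. -/
theorem exists_euler_zero (hU : IsConnected (U : Set ℝ)) (u₀ : U) {g : SmoothFn U}
    (hg : g u₀ = 0) : ∃ G, euler u₀ 0 G = g := by
  obtain ⟨q, hq⟩ := exists_euler_succ hU u₀ 0 (dU U g)
  obtain ⟨r, hr⟩ := exists_euler_succ hU u₀ 0 q
  have h1 := dU_centered_pow_mul u₀ 0 q
  have h2 := dU_centered_pow_mul u₀ 0 r
  rw [hq, zero_add, pow_one, pow_zero, one_mul] at h1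
  rw [hr, zero_add, pow_one, pow_zero, one_mul] at h2
  have h3 : dU U (centered u₀ * q - g) = 0 := by rw [map_sub, h1, sub_self]
  have h4 := eq_smul_one_of_dU_eq_zero hU u₀ h3
  have h5 : (centered u₀ * q - g) u₀ = 0 := by simp [centered_apply, hg]
  rw [h5, zero_smul, sub_eq_zero] at h4
  exact ⟨centered u₀ * r, by rw [euler, h2, h4]; simp⟩

/-- The operator `(u - u₀) d/du + m` is onto the functions that vanish at `u₀` if `m = 0`. -/
theorem exists_euler (hU : IsConnected (U : Set ℝ)) (u₀ : U) {m : ℕ} {g : SmoothFn U}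
    (hg : m = 0 → g u₀ = 0) : ∃ G, euler u₀ m G = g ∧ (g = 0 → G = 0) := by
  -- Choosing zero for zero data ensures that solving coefficient by coefficient creates no new
  -- monomials, so bidegrees are preserved.
  by_cases h : g = 0
  · exact ⟨0, by simp [euler, h], fun _ => rfl⟩
  · cases m with
    | zero => exact (exists_euler_zero hU u₀ (hg rfl)).imp fun _ hG => ⟨hG, fun h' => absurd h' h⟩
    | succ m => exact (exists_euler_succ hU u₀ m g).imp fun _ hG => ⟨hG, fun h' => absurd h' h⟩

/-! ### Multiplication by the centered jet variables -/

theorem thetaDer_thetaMul (R Q : MIdx D) (f : Ahat D U) :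
    thetaDer R (thetaMul Q f) = (if Q = R then f else 0) - thetaMul Q (thetaDer R f) := by
  rw [thetaMul_thetaDer, sub_sub_cancel]

theorem thetaDer_thetaDer (R Q : MIdx D) (f : Ahat D U) :
    thetaDer R (thetaDer Q f) = -thetaDer Q (thetaDer R f) := by
  funext T
  rw [Pi.neg_apply]
  simp only [thetaDer_apply, Finset.mem_insert]
  by_cases h : R = Q
  · subst h
    simp
  by_cases hR : R ∈ T
  · simp [hR]
  by_cases hQ : Q ∈ T
  · simp [hQ]
  rw [if_neg hR, if_neg (by simp [hQ, Ne.symm h]), if_neg hQ, if_neg (by simp [hR, h]), smul_smul,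
    smul_smul, Finset.insert_comm, ← neg_smul, sgn_insert hR, sgn_insert hQ, sgn_singleton h]
  congr 1
  ring

/-- Multiplication by `u^R`, or by `u - u₀` if `R = 0`. -/
def centeredMul (u₀ : U) (R : MIdx D) : Ahat D U →ₗ[ℝ] Ahat D U :=
  jetMul R - (if R = 0 then (u₀ : ℝ) else 0) • LinearMap.id

theorem centeredMul_of_ne (u₀ : U) {R : MIdx D} (hR : R ≠ 0) : centeredMul u₀ R = jetMul R := by
  rw [centeredMul, if_neg hR, zero_smul, sub_zero]

theorem centeredMul_apply (u₀ : U) (R : MIdx D) (f : Ahat D U) :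
    centeredMul u₀ R f = jetMul R f - (if R = 0 then (u₀ : ℝ) else 0) • f :=
  rfl

theorem coeff_jetMul_zero (f : Ahat D U) (T : Finset (MIdx D))
    (n : {S : MIdx D // S ≠ 0} →₀ ℕ) :
    MvPowerSeries.coeff n (jetMul 0 f T) = coordU U * MvPowerSeries.coeff n (f T) := by
  change MvPowerSeries.coeff n (jet 0 * f T) = _
  rw [jet, dif_pos rfl, MvPowerSeries.coeff_C_mul]

theorem coeff_centeredMul_zero (u₀ : U) (f : Ahat D U) (T : Finset (MIdx D))
    (n : {S : MIdx D // S ≠ 0} →₀ ℕ) :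
    MvPowerSeries.coeff n (centeredMul u₀ 0 f T) = centered u₀ * MvPowerSeries.coeff n (f T) := by
  rw [centeredMul_apply, Pi.sub_apply, map_sub, coeff_jetMul_zero, if_pos rfl, Pi.smul_apply,
    coeff_smul_real, centered, sub_mul, smul_mul_assoc, one_mul]

theorem jetDer_centeredMul (u₀ : U) (S R : MIdx D) (f : Ahat D U) :
    jetDer S (centeredMul u₀ R f) =
      (if S = R then f else 0) + centeredMul u₀ R (jetDer S f) := by
  by_cases hR : R = 0
  · subst hR
    funext T
    ext1 n
    by_cases hS : S = 0
    · subst hS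
      rw [if_pos rfl, Pi.add_apply, map_add, coeff_centeredMul_zero]
      refine (derU_zero_apply _ n).trans ?_
      rw [coeff_centeredMul_zero, dU_centered_mul]
      exact congrArg (_ + centered u₀ * ·) (derU_zero_apply _ n).symm
    · rw [if_neg hS, zero_add, coeff_centeredMul_zero]
      refine (coeff_derU hS _ n).trans ?_
      rw [coeff_centeredMul_zero, ← mul_smul_comm]
      exact congrArg (centered u₀ * ·) (coeff_derU hS _ n).symm
  · rw [centeredMul_of_ne u₀ hR, jetDer_jetMul S R hR]

theorem thetaMul_centeredMul (u₀ : U) (S R : MIdx D) (f : Ahat D U) :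
    thetaMul S (centeredMul u₀ R f) = centeredMul u₀ R (thetaMul S f) := by
  rw [centeredMul_apply, centeredMul_apply, map_sub, map_smul, thetaMul_jetMul]

theorem thetaDer_jetMul (S R : MIdx D) (f : Ahat D U) :
    thetaDer S (jetMul R f) = jetMul R (thetaDer S f) := by
  funext T
  change _ = jet R * thetaDer S f T
  rw [thetaDer_apply, thetaDer_apply]
  split_ifs
  · exact (mul_zero _).symm
  · exact (mul_smul_comm _ _ _).symm

theorem thetaDer_centeredMul (u₀ : U) (S R : MIdx D) (f : Ahat D U) :
    thetaDer S (centeredMul u₀ R f) = centeredMul u₀ R (thetaDer S f) := by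
  rw [centeredMul_apply, centeredMul_apply, map_sub, map_smul, thetaDer_jetMul]

theorem jetMul_jetMul (S R : MIdx D) (f : Ahat D U) :
    jetMul S (jetMul R f) = jetMul R (jetMul S f) :=
  funext fun T => mul_left_comm (jet S) (jet R) (f T)

theorem jetMul_centeredMul (u₀ : U) (S R : MIdx D) (f : Ahat D U) :
    jetMul S (centeredMul u₀ R f) = centeredMul u₀ R (jetMul S f) := by
  rw [centeredMul_apply, centeredMul_apply, map_sub, map_smul, jetMul_jetMul]

theorem isLocal_smul_id (c : ℝ) : IsLocal (c • LinearMap.id : Ahat D U →ₗ[ℝ] Ahat D U) := by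
  intro T n
  refine ⟨{(T, n)}, Set.finite_singleton _, fun f hf => ?_⟩
  have := hf _ rfl
  rw [LinearMap.smul_apply, Pi.smul_apply, coeff_smul_real, LinearMap.id_apply, this, smul_zero]

theorem isLocal_centeredMul (u₀ : U) (R : MIdx D) : IsLocal (centeredMul u₀ R) := by
  have h : centeredMul u₀ R =
      jetMul R + (-(if R = 0 then (u₀ : ℝ) else 0)) • LinearMap.id := by
    rw [centeredMul]
    module
  rw [h]
  exact (isLocal_jetMul R).add (isLocal_smul_id _)

/-! ### Commutators of locally finite sums -/

/-- Termwise commutation relations up to the factor `ε` pass to the sums: `ε = 1` serves commutators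
and `ε = -1` anticommutators. Locality moves each operator inside the other's infinite sum. -/
theorem coeff_sumOp_sumOp {L M : MIdx D → Ahat D U →ₗ[ℝ] Ahat D U} (hL : LocallyFinite L)
    (hM : LocallyFinite M) (hL' : ∀ S, IsLocal (L S)) (hM' : ∀ R, IsLocal (M R)) (ε : ℝ)
    (f : Ahat D U) (C : MIdx D → MIdx D → Ahat D U)
    (h : ∀ S R, L S (M R f) = ε • M R (L S f) + C S R)
    (T : Finset (MIdx D)) (n : {S : MIdx D // S ≠ 0} →₀ ℕ) :
    MvPowerSeries.coeff n (sumOp L hL (sumOp M hM f) T) =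
      ε • MvPowerSeries.coeff n (sumOp M hM (sumOp L hL f) T) +
        ∑ᶠ R, ∑ᶠ S, MvPowerSeries.coeff n (C S R T) := by
  have hLM : ∀ R, (Function.support fun S => MvPowerSeries.coeff n (L S (M R f) T)).Finite :=
    fun R => hL.finite (M R f) T n
  have hML' : ∀ R, (Function.support fun S =>
      MvPowerSeries.coeff n (M R (L S f) T)).Finite := fun R => (hL.comp (hM' R)).finite f T n
  have hML : ∀ R, (Function.support fun S =>
      ε • MvPowerSeries.coeff n (M R (L S f) T)).Finite := fun R =>
    (hML' R).subset fun _ hS h => hS (smul_eq_zero_of_right ε h)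
  have hO1 : (Function.support fun R =>
      MvPowerSeries.coeff n (sumOp L hL (M R f) T)).Finite :=
    (hM.comp (isLocal_sumOp hL hL')).finite f T n
  have hO2 : (Function.support fun R => MvPowerSeries.coeff n (M R (sumOp L hL f) T)).Finite :=
    hM.finite (sumOp L hL f) T n
  have hO3 : (Function.support fun R =>
      ε • MvPowerSeries.coeff n (M R (sumOp L hL f) T)).Finite :=
    hO2.subset fun _ hS h => hS (smul_eq_zero_of_right ε h)
  have hC : ∀ S R, MvPowerSeries.coeff n (C S R T) = MvPowerSeries.coeff n (L S (M R f) T) -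
      ε • MvPowerSeries.coeff n (M R (L S f) T) := fun S R => by
    rw [h S R, Pi.add_apply, map_add, Pi.smul_apply, coeff_smul_real, add_sub_cancel_left]
  have e1 : ∀ R, ∑ᶠ S, MvPowerSeries.coeff n (C S R T) =
      MvPowerSeries.coeff n (sumOp L hL (M R f) T) -
        ε • MvPowerSeries.coeff n (M R (sumOp L hL f) T) := fun R => by
    rw [finsum_congr fun S => hC S R, finsum_sub_distrib (hLM R) (hML R),
      ← smul_finsum' ε (hML' R), (hM' R).comp_sumOp hL f T n]
    rfl
  rw [finsum_congr e1, finsum_sub_distrib hO1 hO3, ← smul_finsum' ε hO2,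
    (isLocal_sumOp hL hL').comp_sumOp hM f T n, coeff_sumOp M hM, add_sub_cancel]

/-! ### The contraction with the Euler vector field -/

/-- The operator `v^S ∂/∂θ^{S+ξ_k}`, with `v^S = u^S` for `S ≠ 0` and `v^0 = u - u₀`. -/
def iotaTerm (u₀ : U) (k : Fin D) (S : MIdx D) : Ahat D U →ₗ[ℝ] Ahat D U :=
  centeredMul u₀ S ∘ₗ thetaDer (S + xi k)

theorem isLocal_iotaTerm (u₀ : U) (k : Fin D) (S : MIdx D) : IsLocal (iotaTerm u₀ k S) :=
  (isLocal_centeredMul u₀ S).comp (isLocal_thetaDer _)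

/-- Multiplication by `u^S` reaches the coefficient at `n` only if `S` occurs in `n`. The index `0`
is added because `v^0` is a coefficient function, not a formal variable. -/
theorem locallyFinite_iota (u₀ : U) (k : Fin D) : LocallyFinite (iotaTerm u₀ k) := by
  intro T n
  refine ((Set.finite_singleton 0).union (n.support.finite_toSet.image Subtype.val)).subset ?_
  rintro S ⟨f, hf⟩
  by_contra hS
  rw [Set.mem_union, not_or, Set.mem_singleton_iff] at hS
  refine hf ?_
  rw [iotaTerm, centeredMul_of_ne u₀ hS.1]
  exact coeff_jetMul_eq_zero hS.1 _ T n hS.2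

/-- The operator `∑_S v^S ∂/∂θ^{S+ξ_k}`, with `v^S = u^S` for `S ≠ 0` and `v^0 = u - u₀`. -/
def iota (u₀ : U) (k : Fin D) : Ahat D U →ₗ[ℝ] Ahat D U :=
  sumOp (iotaTerm u₀ k) (locallyFinite_iota u₀ k)

/-- Two corrections arise: `∂/∂θ^{S+ξ_k}` may hit `θ^{R+ξ_j}`, and `∂/∂u^R` may hit `v^S`. They
cancel only after summation over `S` and `R`. -/
theorem iotaTerm_partialTerm (u₀ : U) {k j : Fin D} (S R : MIdx D) (f : Ahat D U) :
    iotaTerm u₀ k S (partialTerm j R f) = (1 : ℝ) • partialTerm j R (iotaTerm u₀ k S f) +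
      ((if R + xi j = S + xi k then centeredMul u₀ S (thetaDer R f) else 0) -
        (if R = S then jetMul (R + xi j) (thetaDer (R + xi k) f) else 0)) := by
  have h1 : centeredMul u₀ S (thetaDer (S + xi k) (jetMul (R + xi j) (jetDer R f))) =
      jetMul (R + xi j) (jetDer R (centeredMul u₀ S (thetaDer (S + xi k) f))) -
        (if R = S then jetMul (R + xi j) (thetaDer (R + xi k) f) else 0) := by
    rw [jetDer_centeredMul, map_add, jetMul_centeredMul, thetaDer_jetMul, jetDer_thetaDer]
    split_ifs with h
    · rw [h]
      abel
    · rw [map_zero]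
      abel
  have h2 : centeredMul u₀ S (thetaDer (S + xi k) (thetaMul (R + xi j) (thetaDer R f))) =
      thetaMul (R + xi j) (thetaDer R (centeredMul u₀ S (thetaDer (S + xi k) f))) +
        (if R + xi j = S + xi k then centeredMul u₀ S (thetaDer R f) else 0) := by
    rw [thetaDer_thetaMul, thetaDer_centeredMul, thetaMul_centeredMul, map_sub,
      thetaDer_thetaDer (S + xi k) R, map_neg, map_neg, sub_neg_eq_add, add_comm]
    congr 1
    split_ifs
    · rfl
    · exact map_zero _
  change centeredMul u₀ S (thetaDer (S + xi k) (jetMul (R + xi j) (jetDer R f) +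
      thetaMul (R + xi j) (thetaDer R f))) =
    (1 : ℝ) • (jetMul (R + xi j) (jetDer R (centeredMul u₀ S (thetaDer (S + xi k) f))) +
      thetaMul (R + xi j) (thetaDer R (centeredMul u₀ S (thetaDer (S + xi k) f)))) + _
  rw [map_add, map_add, h1, h2, one_smul]
  abel

/-- Comparing the `k`-th entries shows that `R` contains `ξ_k`. This fails for `j = k`, where `R =
S` is arbitrary; it is the reason the contraction commutes only with the other total derivatives. -/
theorem exists_add_xi_of_add_xi_eq {k j : Fin D} (hjk : j ≠ k) {S R : MIdx D}
    (h : R + xi j = S + xi k) : ∃ Q, R = Q + xi k ∧ S = Q + xi j := by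
  have hk := congrFun h k
  simp only [xi, Pi.add_apply, Pi.single_eq_same, Pi.single_eq_of_ne hjk.symm, add_zero] at hk
  have hle : xi k ≤ R := fun l => by
    by_cases hl : l = k
    · subst hl
      simp [xi, hk]
    · simp [xi, hl]
  refine ⟨R - xi k, (tsub_add_cancel_of_le hle).symm, ?_⟩
  refine add_right_cancel (b := xi k) ?_
  rw [← h, add_right_comm, tsub_add_cancel_of_le hle]

/-- The contraction commutes with the total derivatives in the other directions. -/
theorem iota_partialX (u₀ : U) {k j : Fin D} (hjk : j ≠ k) (f : Ahat D U) :
    iota u₀ k (partialX j f) = partialX j (iota u₀ k f) := by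
  funext T
  ext1 n
  set g : MIdx D → SmoothFn U := fun Q =>
    MvPowerSeries.coeff n (jetMul (Q + xi j) (thetaDer (Q + xi k) f) T) with hg
  have hgfin : (Function.support g).Finite := by
    refine (finite_add_xi j (n.support.finite_toSet.image Subtype.val)).subset fun Q hQ => ?_
    by_contra h
    exact hQ (coeff_jetMul_eq_zero (add_xi_ne_zero Q j) _ T n h)
  refine (coeff_sumOp_sumOp (locallyFinite_iota u₀ k) (locallyFinite_partialX j)
    (isLocal_iotaTerm u₀ k) (isLocal_partialX_term j) 1 f _
    (fun S R => iotaTerm_partialTerm u₀ S R f) T n).trans ?_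
  rw [one_smul]
  refine add_eq_left.2 ?_
  -- Both corrections sum to `∑ g Q`, one directly and the other after the substitution `R = Q +
  -- ξ_k`, `S = Q + ξ_j`.
  obtain ⟨h2, h3⟩ := finsum_shift k g hgfin
  have h4 : ∀ R : MIdx D, ∑ᶠ S : MIdx D, MvPowerSeries.coeff n
      (((if R + xi j = S + xi k then centeredMul u₀ S (thetaDer R f) else 0) -
        (if R = S then jetMul (R + xi j) (thetaDer (R + xi k) f) else 0) : Ahat D U) T) =
      (∑ᶠ Q, if Q + xi k = R then g Q else 0) - g R := by
    intro R
    have e1 : (Function.support fun S : MIdx D => MvPowerSeries.coeff n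
        ((if R + xi j = S + xi k then centeredMul u₀ S (thetaDer R f) else 0 : Ahat D U) T)).Finite :=
      (finite_add_xi k (Set.finite_singleton (R + xi j))).subset fun S hS => by
        by_contra h
        refine hS ?_
        dsimp only
        rw [if_neg fun h' => h h'.symm]
        exact map_zero _
    have e2 : (Function.support fun S : MIdx D => MvPowerSeries.coeff n
        ((if R = S then jetMul (R + xi j) (thetaDer (R + xi k) f) else 0 : Ahat D U) T)).Finite :=
      (Set.finite_singleton R).subset fun S hS => by
        by_contra h
        refine hS ?_
        dsimp only
        rw [if_neg fun h' => h h'.symm]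
        exact map_zero _
    rw [finsum_congr fun S => by rw [Pi.sub_apply, map_sub], finsum_sub_distrib e1 e2]
    congr 1
    · by_cases hR : ∃ Q, R = Q + xi k
      · obtain ⟨Q, rfl⟩ := hR
        -- The only contributing `S` is `Q + ξ_j`, which is nonzero, so the centering at `u₀` does
        -- not interfere with the cancellation.
        rw [finsum_eq_single _ (Q + xi j), finsum_eq_single _ Q, if_pos rfl,
          if_pos (add_right_comm _ _ _), centeredMul_of_ne u₀ (add_xi_ne_zero Q j)]
        · exact fun Q' hQ' => if_neg fun h => hQ' (add_right_cancel h)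
        · intro S hS
          rw [if_neg]
          · exact map_zero _
          · intro h
            obtain ⟨Q', h1, h1'⟩ := exists_add_xi_of_add_xi_eq hjk h
            exact hS (by rw [h1', add_right_cancel h1])
      · rw [finsum_congr fun Q => if_neg fun h => hR ⟨Q, h.symm⟩, finsum_zero]
        refine (finsum_congr fun S => ?_).trans finsum_zero
        rw [if_neg]
        · exact map_zero _
        · exact fun h => hR ((exists_add_xi_of_add_xi_eq hjk h).imp fun _ h => h.1)
    · rw [finsum_eq_single _ R, if_pos rfl]
      intro S hS
      rw [if_neg (Ne.symm hS)]
      exact map_zero _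
  rw [finsum_congr h4, finsum_sub_distrib h2 hgfin, h3, sub_self]

/-! ### The Euler operator -/

/-- The weight of a monomial: the number of factors `u^S` and `θ^{S+ξ_k}`. -/
def weight (k : Fin D) (T : Finset (MIdx D)) (n : {S : MIdx D // S ≠ 0} →₀ ℕ) : ℕ :=
  ∑ S ∈ n.support, n S + (T.filter fun S => S k ≠ 0).card

/-- Only the diagonal `S = R` leaves a correction: `∂/∂u^S` hits `v^R` exactly when `∂/∂θ^{R+ξ_k}`
hits `θ^{S+ξ_k}`. -/
theorem deltaTerm_iotaTerm (u₀ : U) (k : Fin D) (S R : MIdx D) (f : Ahat D U) :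
    deltaTerm k S (iotaTerm u₀ k R f) = (-1 : ℝ) • iotaTerm u₀ k R (deltaTerm k S f) +
      (if S = R then centeredMul u₀ R (jetDer R f) +
        thetaMul (R + xi k) (thetaDer (R + xi k) f) else 0) := by
  change thetaMul (S + xi k) (jetDer S (centeredMul u₀ R (thetaDer (R + xi k) f))) =
    (-1 : ℝ) • centeredMul u₀ R (thetaDer (R + xi k) (thetaMul (S + xi k) (jetDer S f))) + _
  rw [jetDer_centeredMul, map_add, thetaMul_centeredMul, jetDer_thetaDer, thetaDer_thetaMul,
    map_sub, neg_one_smul, neg_sub]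
  by_cases h : S = R
  · subst h
    simp only [if_true]
    abel
  · rw [if_neg h, if_neg h, if_neg fun h' => h (add_right_cancel h'), map_zero, map_zero]
    abel

theorem coeff_centeredMul_jetDer (u₀ : U) (S : {S : MIdx D // S ≠ 0}) (f : Ahat D U)
    (T : Finset (MIdx D)) (n : {S : MIdx D // S ≠ 0} →₀ ℕ) :
    MvPowerSeries.coeff n (centeredMul u₀ S.1 (jetDer S.1 f) T) =
      (n S : ℝ) • MvPowerSeries.coeff n (f T) := by
  rw [centeredMul_of_ne u₀ S.2]
  change MvPowerSeries.coeff n (jet S.1 * derU S.1 (f T)) = _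
  rw [jet, dif_neg S.2, MvPowerSeries.X, MvPowerSeries.coeff_monomial_mul, one_mul]
  by_cases h : n S = 0
  · rw [if_neg, h, Nat.cast_zero, zero_smul]
    intro hle
    have := hle S
    simp [h] at this
  · have hle : Finsupp.single S 1 ≤ n := by
      rw [Finsupp.single_le_iff]
      omega
    rw [if_pos hle, coeff_derU S.2, tsub_add_cancel_of_le hle]
    congr 1
    rw [Finsupp.tsub_apply, Finsupp.single_eq_same]
    congr 1
    exact Nat.sub_add_cancel (Nat.one_le_iff_ne_zero.2 h)

theorem thetaMul_thetaDer_self (R : MIdx D) (f : Ahat D U) (T : Finset (MIdx D)) :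
    thetaMul R (thetaDer R f) T = if R ∈ T then f T else 0 := by
  rw [thetaMul_apply]
  split_ifs with h
  · rw [thetaDer_apply, if_neg (Finset.notMem_erase R T), Finset.insert_erase h, smul_smul,
      sgn_mul_self, one_smul]
  · rfl

/-- The Euler operator `(u - u₀) ∂/∂u + ∑_{S ≠ 0} u^S ∂/∂u^S + ∑_S θ^{S+ξ_k} ∂/∂θ^{S+ξ_k}`,
as the anticommutator of `Delta k` and the contraction. -/
def eulerOp (u₀ : U) (k : Fin D) : Ahat D U →ₗ[ℝ] Ahat D U :=
  Delta k ∘ₗ iota u₀ k + iota u₀ k ∘ₗ Delta k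

theorem eulerOp_apply (u₀ : U) (k : Fin D) (f : Ahat D U) :
    eulerOp u₀ k f = Delta k (iota u₀ k f) + iota u₀ k (Delta k f) :=
  rfl

theorem xi_le_iff {k : Fin D} {S : MIdx D} : xi k ≤ S ↔ S k ≠ 0 := by
  constructor
  · intro h
    have := h k
    simp [xi] at this
    omega
  · intro h l
    by_cases hl : l = k
    · subst hl
      simp [xi]
      omega
    · simp [xi, hl]

/-- For `S ≠ 0`, `u^S ∂/∂u^S` multiplies by the exponent of `u^S`; `θ^{S+ξ_k} ∂/∂θ^{S+ξ_k}`
multiplies by one or zero. Their eigenvalues add up to the weight, and the index `0` contributes `(u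
- u₀) d/du`. -/
theorem coeff_eulerOp (u₀ : U) (k : Fin D) (f : Ahat D U) (T : Finset (MIdx D))
    (n : {S : MIdx D // S ≠ 0} →₀ ℕ) :
    MvPowerSeries.coeff n (eulerOp u₀ k f T) =
      euler u₀ (weight k T n) (MvPowerSeries.coeff n (f T)) := by
  classical
  set a := MvPowerSeries.coeff n (f T) with ha
  have h1 := coeff_sumOp_sumOp (locallyFinite_Delta k) (locallyFinite_iota u₀ k)
    (isLocal_deltaTerm k) (isLocal_iotaTerm u₀ k) (-1) f _
    (fun S R => deltaTerm_iotaTerm u₀ k S R f) T n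
  have h2 : ∀ R : MIdx D, ∑ᶠ S : MIdx D, MvPowerSeries.coeff n
      ((if S = R then centeredMul u₀ R (jetDer R f) +
        thetaMul (R + xi k) (thetaDer (R + xi k) f) else 0 : Ahat D U) T) =
      MvPowerSeries.coeff n (centeredMul u₀ R (jetDer R f) T) +
        (if R + xi k ∈ T then a else 0) := by
    intro R
    rw [finsum_eq_single _ R, if_pos rfl, Pi.add_apply, map_add, thetaMul_thetaDer_self]
    · split_ifs
      · rfl
      · simp
    · intro S hS
      rw [if_neg hS]
      exact map_zero _
  have hJ : (Function.support fun R : MIdx D =>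
      MvPowerSeries.coeff n (centeredMul u₀ R (jetDer R f) T)) ⊆
      (insert 0 (n.support.map (Function.Embedding.subtype _)) : Finset (MIdx D)) := by
    intro R hR
    by_cases h0 : R = 0
    · simp [h0]
    · refine Finset.mem_insert_of_mem (Finset.mem_map.2 ⟨⟨R, h0⟩, ?_, rfl⟩)
      rw [Finsupp.mem_support_iff]
      intro h
      refine hR ((coeff_centeredMul_jetDer u₀ ⟨R, h0⟩ f T n).trans ?_)
      rw [h, Nat.cast_zero, zero_smul]
  -- The truncated subtraction of `ξ_k` is an honest one on the filtered set, whose members have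
  -- nonzero `k`-th entry.
  have hT : (Function.support fun R : MIdx D => if R + xi k ∈ T then a else 0) ⊆
      ((T.filter fun S => S k ≠ 0).image (· - xi k) : Finset (MIdx D)) := by
    intro R hR
    have hR' : R + xi k ∈ T := by
      by_contra h
      exact hR (if_neg h)
    refine Finset.mem_image.2 ⟨R + xi k, Finset.mem_filter.2 ⟨hR', by simp [xi]⟩, ?_⟩
    exact add_tsub_cancel_right R (xi k)
  have e1 : ∑ᶠ R : MIdx D, MvPowerSeries.coeff n (centeredMul u₀ R (jetDer R f) T) =
      centered u₀ * dU U a + ((∑ S ∈ n.support, n S : ℕ) : ℝ) • a := by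
    rw [finsum_eq_sum_of_support_subset _ hJ, Finset.sum_insert (by simp), Finset.sum_map,
      coeff_centeredMul_zero]
    congr 1
    · exact congrArg _ (derU_zero_apply _ n)
    · rw [Nat.cast_sum, Finset.sum_smul]
      exact Finset.sum_congr rfl fun S _ => coeff_centeredMul_jetDer u₀ S f T n
  have e2 : ∑ᶠ R : MIdx D, (if R + xi k ∈ T then a else 0) =
      ((T.filter fun S => S k ≠ 0).card : ℝ) • a := by
    rw [finsum_eq_sum_of_support_subset _ hT, Finset.sum_image, Finset.sum_congr rfl
      (g := fun _ => a), Finset.sum_const, Nat.cast_smul_eq_nsmul]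
    · intro S hS
      rw [Finset.mem_filter] at hS
      rw [tsub_add_cancel_of_le (xi_le_iff.2 hS.2), if_pos hS.1]
    · intro S hS S' hS' h
      rw [Finset.mem_coe, Finset.mem_filter] at hS hS'
      have h' := congrArg (· + xi k) h
      simpa only [tsub_add_cancel_of_le (xi_le_iff.2 hS.2),
        tsub_add_cancel_of_le (xi_le_iff.2 hS'.2)] using h'
  rw [finsum_congr h2, finsum_add_distrib ((Finset.finite_toSet _).subset hJ)
    ((Finset.finite_toSet _).subset hT), e1, e2] at h1
  rw [eulerOp_apply, Pi.add_apply, map_add, euler, weight, Nat.cast_add, add_smul, ← add_assoc]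
  refine (congrArg (· + _) h1).trans ?_
  rw [neg_one_smul]
  change -MvPowerSeries.coeff n (iota u₀ k (Delta k f) T) + _ +
    MvPowerSeries.coeff n (iota u₀ k (Delta k f) T) = _
  abel

/-! ### The projection to the kernel of the Euler operator -/

/-- The projection to the kernel of the Euler operator: it keeps the monomials of weight zero
and evaluates their coefficients at `u₀`. -/
def eulerProj (u₀ : U) (k : Fin D) : Ahat D U →ₗ[ℝ] Ahat D U where
  toFun f T n := if weight k T n = 0 then (MvPowerSeries.coeff n (f T) u₀) • 1 else 0
  map_add' f g := by
    funext T n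
    change _ = ite (weight k T n = 0) ((MvPowerSeries.coeff n (f T) u₀) • (1 : SmoothFn U)) 0 +
      ite (weight k T n = 0) ((MvPowerSeries.coeff n (g T) u₀) • (1 : SmoothFn U)) 0
    split_ifs
    · rw [Pi.add_apply, map_add, ContMDiffMap.coe_add, Pi.add_apply, add_smul]
    · rw [add_zero]
  map_smul' c f := by
    funext T n
    change _ = c • ite (weight k T n = 0) ((MvPowerSeries.coeff n (f T) u₀) • (1 : SmoothFn U)) 0
    split_ifs
    · rw [Pi.smul_apply, coeff_smul_real, ContMDiffMap.coe_smul, Pi.smul_apply, smul_assoc]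
    · rw [smul_zero]

theorem coeff_eulerProj (u₀ : U) (k : Fin D) (f : Ahat D U) (T : Finset (MIdx D))
    (n : {S : MIdx D // S ≠ 0} →₀ ℕ) :
    MvPowerSeries.coeff n (eulerProj u₀ k f T) =
      if weight k T n = 0 then (MvPowerSeries.coeff n (f T) u₀) • 1 else 0 :=
  rfl

theorem euler_zero_right (u₀ : U) (m : ℕ) : euler u₀ m 0 = 0 := by
  simp [euler]

theorem eulerOp_eulerProj (u₀ : U) (k : Fin D) (f : Ahat D U) :
    eulerOp u₀ k (eulerProj u₀ k f) = 0 := by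
  funext T
  ext1 n
  rw [coeff_eulerOp, coeff_eulerProj]
  refine Eq.trans ?_ (map_zero _).symm
  split_ifs with h
  · rw [h, euler, dU_smul_one]
    simp
  · exact euler_zero_right _ _

theorem eulerProj_eulerOp (u₀ : U) (k : Fin D) (f : Ahat D U) :
    eulerProj u₀ k (eulerOp u₀ k f) = 0 := by
  funext T
  ext1 n
  rw [coeff_eulerProj]
  refine Eq.trans ?_ (map_zero _).symm
  split_ifs with h
  · rw [coeff_eulerOp, h, euler_apply_center]
    simp
  · rfl

/-- Positive weights contribute nothing to the kernel, and weight zero contributes functions with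
zero derivative, hence constants on the connected set `U`. -/
theorem eulerProj_eq_self_of_eulerOp_eq_zero (hU : IsConnected (U : Set ℝ)) {u₀ : U} {k : Fin D}
    {f : Ahat D U} (h : eulerOp u₀ k f = 0) : eulerProj u₀ k f = f := by
  funext T
  ext1 n
  have h1 := coeff_eulerOp u₀ k f T n
  rw [h, Pi.zero_apply, map_zero] at h1
  rw [coeff_eulerProj]
  split_ifs with hw
  · rw [hw] at h1
    exact (eq_smul_one_of_dU_eq_zero hU u₀ (dU_eq_zero_of_euler_zero hU h1.symm)).symm
  · obtain ⟨m, hm⟩ := Nat.exists_eq_succ_of_ne_zero hw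
    rw [hm] at h1
    exact (eq_zero_of_euler_succ hU h1.symm).symm

/-- Subtracting the projection makes every weight-zero coefficient vanish at `u₀`, which is the
solvability condition there. The last clause will give bihomogeneous solutions for bihomogeneous
data. -/
theorem exists_eulerOp_eq (hU : IsConnected (U : Set ℝ)) (u₀ : U) (k : Fin D) (f : Ahat D U) :
    ∃ g, eulerOp u₀ k g = f - eulerProj u₀ k f ∧
      ∀ T n, MvPowerSeries.coeff n (f T) = 0 → MvPowerSeries.coeff n (g T) = 0 := by
  have h : ∀ (T : Finset (MIdx D)) (n : {S : MIdx D // S ≠ 0} →₀ ℕ), ∃ G : SmoothFn U,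
      euler u₀ (weight k T n) G = MvPowerSeries.coeff n ((f - eulerProj u₀ k f) T) ∧
        (MvPowerSeries.coeff n ((f - eulerProj u₀ k f) T) = 0 → G = 0) := by
    intro T n
    refine exists_euler hU u₀ fun hw => ?_
    rw [Pi.sub_apply, map_sub, coeff_eulerProj, if_pos hw]
    change MvPowerSeries.coeff n (f T) u₀ - ((MvPowerSeries.coeff n (f T) u₀) • (1 : SmoothFn U)) u₀ = 0
    simp
  choose G hG hG0 using h
  refine ⟨fun T n => G T n, ?_, fun T n hf => hG0 T n ?_⟩
  · funext T
    ext1 n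
    exact (coeff_eulerOp u₀ k _ T n).trans (hG T n)
  · rw [Pi.sub_apply, map_sub, coeff_eulerProj, hf]
    simp

theorem mem_homog_of_coeff {p d : ℤ} {f g : Ahat D U} (hf : f ∈ homog D U p d)
    (h : ∀ T n, MvPowerSeries.coeff n (f T) = 0 → MvPowerSeries.coeff n (g T) = 0) :
    g ∈ homog D U p d :=
  fun T n hg => hf T n fun h0 => hg (h T n h0)

theorem eulerProj_mem_homog (u₀ : U) (k : Fin D) {p d : ℤ} {f : Ahat D U}
    (hf : f ∈ homog D U p d) : eulerProj u₀ k f ∈ homog D U p d :=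
  mem_homog_of_coeff hf fun T n h => by rw [coeff_eulerProj, h]; simp

theorem weight_insert_ne_zero (k : Fin D) (S : MIdx D) (T : Finset (MIdx D))
    (n : {S : MIdx D // S ≠ 0} →₀ ℕ) : weight k (insert (S + xi k) T) n ≠ 0 := by
  have h : S + xi k ∈ (insert (S + xi k) T).filter fun S => S k ≠ 0 := by simp [xi]
  have := Finset.card_pos.2 ⟨_, h⟩
  rw [weight]
  omega

theorem weight_add_single_ne_zero (k : Fin D) (S : {S : MIdx D // S ≠ 0}) (T : Finset (MIdx D))
    (n : {S : MIdx D // S ≠ 0} →₀ ℕ) : weight k T (n + Finsupp.single S 1) ≠ 0 := by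
  have h : S ∈ (n + Finsupp.single S 1).support := by simp
  have h1 := Finset.single_le_sum
    (f := ⇑(n + Finsupp.single S 1 : {S : MIdx D // S ≠ 0} →₀ ℕ)) (fun _ _ => Nat.zero_le _) h
  rw [Finsupp.add_apply, Finsupp.single_eq_same] at h1
  rw [weight]
  omega

/-! ### Compatibility of the projection with the differential, the contraction and the total
derivatives -/

theorem thetaDer_eulerProj (u₀ : U) (k : Fin D) (S : MIdx D) (f : Ahat D U) :
    thetaDer (S + xi k) (eulerProj u₀ k f) = 0 := by
  funext T
  ext1 n
  refine Eq.trans ?_ (map_zero _).symm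
  rw [thetaDer_apply]
  split_ifs
  · exact map_zero _
  · rw [coeff_smul_real, coeff_eulerProj, if_neg (weight_insert_ne_zero k S T n), smul_zero]

theorem jetDer_eulerProj (u₀ : U) (k : Fin D) (S : MIdx D) (f : Ahat D U) :
    jetDer S (eulerProj u₀ k f) = 0 := by
  funext T
  ext1 n
  refine Eq.trans ?_ (map_zero _).symm
  by_cases hS : S = 0
  · subst hS
    refine (derU_zero_apply _ n).trans ?_
    rw [coeff_eulerProj]
    split_ifs
    · exact dU_smul_one _
    · exact map_zero _
  · refine (coeff_derU hS _ n).trans ?_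
    rw [coeff_eulerProj, if_neg (weight_add_single_ne_zero k ⟨S, hS⟩ T n), smul_zero]

theorem sumOp_eq_zero {L : MIdx D → Ahat D U →ₗ[ℝ] Ahat D U} (hL : LocallyFinite L)
    {f : Ahat D U} (h : ∀ S, L S f = 0) : sumOp L hL f = 0 := by
  funext T
  ext1 n
  rw [coeff_sumOp]
  refine (finsum_congr fun S => ?_).trans finsum_zero
  rw [h]
  exact map_zero _

theorem Delta_eulerProj (u₀ : U) (k : Fin D) (f : Ahat D U) : Delta k (eulerProj u₀ k f) = 0 :=
  sumOp_eq_zero _ fun S => by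
    rw [deltaTerm, LinearMap.comp_apply, jetDer_eulerProj, map_zero]

theorem iota_eulerProj (u₀ : U) (k : Fin D) (f : Ahat D U) : iota u₀ k (eulerProj u₀ k f) = 0 :=
  sumOp_eq_zero _ fun S => by
    rw [iotaTerm, LinearMap.comp_apply, thetaDer_eulerProj, map_zero]

theorem eulerOp_partialX (u₀ : U) {k j : Fin D} (hjk : j ≠ k) (f : Ahat D U) :
    eulerOp u₀ k (partialX j f) = partialX j (eulerOp u₀ k f) := by
  rw [eulerOp_apply, eulerOp_apply, iota_partialX u₀ hjk, Delta_partialX, Delta_partialX,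
    iota_partialX u₀ hjk, map_add]

theorem eulerOp_Delta (u₀ : U) (k : Fin D) (f : Ahat D U) :
    eulerOp u₀ k (Delta k f) = Delta k (eulerOp u₀ k f) := by
  rw [eulerOp_apply, eulerOp_apply, Delta_Delta, map_zero, add_zero, map_add, Delta_Delta, zero_add]

/-- Apply `∂_{x^j}` to the splitting of `f` into kernel and image of the Euler operator. Commutation
keeps each summand in its own space, so the projection selects the first. -/
theorem eulerProj_partialX (hU : IsConnected (U : Set ℝ)) (u₀ : U) {k j : Fin D} (hjk : j ≠ k)
    (f : Ahat D U) : eulerProj u₀ k (partialX j f) = partialX j (eulerProj u₀ k f) := by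
  obtain ⟨g, hg, -⟩ := exists_eulerOp_eq hU u₀ k f
  have h1 : partialX j f = partialX j (eulerProj u₀ k f) + eulerOp u₀ k (partialX j g) := by
    rw [eulerOp_partialX u₀ hjk, hg, map_sub, add_sub_cancel]
  rw [h1, map_add, eulerProj_eulerOp, add_zero]
  refine eulerProj_eq_self_of_eulerOp_eq_zero hU ?_
  rw [eulerOp_partialX u₀ hjk, eulerOp_eulerProj, map_zero]

/-- Since `Delta k` kills the projected part of `f`, `Delta k f` lies in the image of the Euler
operator. -/
theorem eulerProj_Delta (hU : IsConnected (U : Set ℝ)) (u₀ : U) (k : Fin D) (f : Ahat D U) :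
    eulerProj u₀ k (Delta k f) = 0 := by
  obtain ⟨g, hg, -⟩ := exists_eulerOp_eq hU u₀ k f
  have h1 : Delta k f = eulerOp u₀ k (Delta k g) := by
    rw [eulerOp_Delta, hg, map_sub, Delta_eulerProj, sub_zero]
  rw [h1, eulerProj_eulerOp]

/-! ### Bihomogeneous components -/

/-- The bidegree of a monomial. -/
def bidegree (T : Finset (MIdx D)) (n : {S : MIdx D // S ≠ 0} →₀ ℕ) : ℤ × ℤ :=
  (T.card, ((n.sum fun S m => m * len S.1) + ∑ S ∈ T, len S : ℕ))

/-- The projection to the bihomogeneous component of bidegree `q`. -/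
def bidegreePart (q : ℤ × ℤ) : Ahat D U →ₗ[ℝ] Ahat D U where
  toFun f T n := if bidegree T n = q then MvPowerSeries.coeff n (f T) else 0
  map_add' f g := by
    funext T n
    change _ = ite (bidegree T n = q) (MvPowerSeries.coeff n (f T)) 0 +
      ite (bidegree T n = q) (MvPowerSeries.coeff n (g T)) 0
    split_ifs
    · rw [Pi.add_apply, map_add]
    · rw [add_zero]
  map_smul' c f := by
    funext T n
    change _ = c • ite (bidegree T n = q) (MvPowerSeries.coeff n (f T)) 0
    split_ifs
    · rw [Pi.smul_apply, coeff_smul_real]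
    · rw [smul_zero]

theorem coeff_bidegreePart (q : ℤ × ℤ) (f : Ahat D U) (T : Finset (MIdx D))
    (n : {S : MIdx D // S ≠ 0} →₀ ℕ) :
    MvPowerSeries.coeff n (bidegreePart q f T) =
      if bidegree T n = q then MvPowerSeries.coeff n (f T) else 0 :=
  rfl

theorem bidegreePart_mem_homog (p d : ℤ) (f : Ahat D U) :
    bidegreePart (p, d) f ∈ homog D U p d := by
  intro T n h
  rw [coeff_bidegreePart] at h
  have h1 : bidegree T n = (p, d) := by
    by_contra h1
    exact h (if_neg h1)
  exact ⟨congrArg Prod.fst h1, congrArg Prod.snd h1⟩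

theorem bidegreePart_of_mem_homog {p d : ℤ} {f : Ahat D U} (hf : f ∈ homog D U p d)
    (q : ℤ × ℤ) : bidegreePart q f = if q = (p, d) then f else 0 := by
  funext T
  ext1 n
  rw [coeff_bidegreePart]
  by_cases h : MvPowerSeries.coeff n (f T) = 0
  · rw [h, ite_self]
    split_ifs
    · exact h.symm
    · exact (map_zero _).symm
  · have h1 : bidegree T n = (p, d) := Prod.ext (hf T n h).1 (hf T n h).2
    rw [h1]
    by_cases hq : q = (p, d)
    · rw [if_pos hq, if_pos hq.symm]
    · rw [if_neg hq, if_neg (Ne.symm hq)]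
      exact (map_zero _).symm

/-- An operator is bihomogeneous of bidegree `s`. -/
def HasBidegree (L : Ahat D U →ₗ[ℝ] Ahat D U) (s : ℤ × ℤ) : Prop :=
  ∀ q f, L (bidegreePart q f) = bidegreePart (q + s) (L f)

theorem HasBidegree.map_mem_homog {L : Ahat D U →ₗ[ℝ] Ahat D U} {s : ℤ × ℤ}
    (hL : HasBidegree L s) {p d p' d' : ℤ} (h : (p, d) + s = (p', d')) {f : Ahat D U}
    (hf : f ∈ homog D U p d) : L f ∈ homog D U p' d' := by
  have h1 := hL (p, d) f
  rw [bidegreePart_of_mem_homog hf, if_pos rfl, h] at h1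
  rw [h1]
  exact bidegreePart_mem_homog _ _ _

theorem HasBidegree.comp {L M : Ahat D U →ₗ[ℝ] Ahat D U} {s t : ℤ × ℤ} (hL : HasBidegree L s)
    (hM : HasBidegree M t) {r : ℤ × ℤ} (h : t + s = r) : HasBidegree (L ∘ₗ M) r := by
  intro q f
  rw [LinearMap.comp_apply, hM, hL, add_assoc, h, LinearMap.comp_apply]

theorem HasBidegree.add {L M : Ahat D U →ₗ[ℝ] Ahat D U} {s : ℤ × ℤ} (hL : HasBidegree L s)
    (hM : HasBidegree M s) : HasBidegree (L + M) s := by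
  intro q f
  rw [LinearMap.add_apply, hL, hM, LinearMap.add_apply, map_add]

theorem isLocal_bidegreePart (q : ℤ × ℤ) : IsLocal (bidegreePart (U := U) (D := D) q) := by
  intro T n
  refine ⟨{(T, n)}, Set.finite_singleton _, fun f hf => ?_⟩
  have := hf _ rfl
  rw [coeff_bidegreePart, this, ite_self]

theorem hasBidegree_sumOp {L : MIdx D → Ahat D U →ₗ[ℝ] Ahat D U} (hL : LocallyFinite L)
    {s : ℤ × ℤ} (h : ∀ S, HasBidegree (L S) s) : HasBidegree (sumOp L hL) s := by
  intro q f
  funext T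
  ext1 n
  rw [(isLocal_bidegreePart (q + s)).comp_sumOp hL f T n, coeff_sumOp]
  exact finsum_congr fun S => by rw [h S q f]

theorem bidegree_add_single (T : Finset (MIdx D)) (n : {S : MIdx D // S ≠ 0} →₀ ℕ)
    (S : {S : MIdx D // S ≠ 0}) :
    bidegree T (n + Finsupp.single S 1) = bidegree T n + (0, (len S.1 : ℤ)) := by
  rw [bidegree, bidegree, Finsupp.sum_add_index' (fun _ => zero_mul _) (fun _ _ _ => add_mul _ _ _),
    Finsupp.sum_single_index (zero_mul _), one_mul, Prod.mk_add_mk, add_zero]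
  push_cast
  rw [add_right_comm]

theorem bidegree_insert {T : Finset (MIdx D)} (n : {S : MIdx D // S ≠ 0} →₀ ℕ) {R : MIdx D}
    (hR : R ∉ T) : bidegree (insert R T) n = bidegree T n + (1, (len R : ℤ)) := by
  rw [bidegree, bidegree, Finset.card_insert_of_notMem hR, Finset.sum_insert hR, Prod.mk_add_mk]
  push_cast
  rw [add_comm (len R : ℤ), add_assoc]

theorem len_zero : len (0 : MIdx D) = 0 := by
  simp [len]

theorem len_add_xi (S : MIdx D) (i : Fin D) : len (S + xi i) = len S + 1 := by
  simp [len, xi, Finset.sum_add_distrib]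

theorem hasBidegree_jetMul (R : MIdx D) : HasBidegree (jetMul (U := U) R) (0, (len R : ℤ)) := by
  intro q f
  funext T
  ext1 n
  rw [coeff_bidegreePart]
  by_cases hR : R = 0
  · subst hR
    rw [coeff_jetMul_zero, coeff_jetMul_zero, coeff_bidegreePart, len_zero, Nat.cast_zero,
      Prod.mk_zero_zero, add_zero, mul_ite, mul_zero]
  · change MvPowerSeries.coeff n (jet R * bidegreePart q f T) =
      if _ then MvPowerSeries.coeff n (jet R * f T) else 0
    rw [jet, dif_neg hR, MvPowerSeries.X, MvPowerSeries.coeff_monomial_mul,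
      MvPowerSeries.coeff_monomial_mul]
    by_cases h : Finsupp.single (⟨R, hR⟩ : {S : MIdx D // S ≠ 0}) 1 ≤ n
    · rw [if_pos h, if_pos h, one_mul, one_mul, coeff_bidegreePart]
      have h1 := bidegree_add_single T (n - Finsupp.single ⟨R, hR⟩ 1) ⟨R, hR⟩
      rw [tsub_add_cancel_of_le h] at h1
      simp only [h1, add_left_inj]
    · rw [if_neg h, if_neg h, ite_self]

theorem hasBidegree_centeredMul (u₀ : U) (R : MIdx D) :
    HasBidegree (centeredMul u₀ R) (0, (len R : ℤ)) := by
  intro q f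
  rw [centeredMul_apply, centeredMul_apply, map_sub, map_smul, hasBidegree_jetMul]
  -- The constant `u₀` occurs only for `R = 0`, where multiplication has degree zero, so centering
  -- does not spoil homogeneity.
  by_cases hR : R = 0
  · rw [hR, len_zero, Nat.cast_zero, Prod.mk_zero_zero, add_zero]
  · rw [if_neg hR, zero_smul, zero_smul]

theorem hasBidegree_jetDer (S : MIdx D) : HasBidegree (jetDer (U := U) S) (0, -(len S : ℤ)) := by
  intro q f
  funext T
  ext1 n
  rw [coeff_bidegreePart]
  change MvPowerSeries.coeff n (derU S (bidegreePart q f T)) =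
    if _ then MvPowerSeries.coeff n (derU S (f T)) else 0
  by_cases hS : S = 0
  · subst hS
    rw [derU_zero_apply, derU_zero_apply, coeff_bidegreePart, len_zero, Nat.cast_zero, neg_zero,
      Prod.mk_zero_zero, add_zero]
    split_ifs
    · rfl
    · exact map_zero _
  · rw [coeff_derU hS, coeff_derU hS, coeff_bidegreePart, bidegree_add_single, smul_ite, smul_zero]
    have h1 : ∀ b : ℤ × ℤ, b + (0, (len S : ℤ)) = q ↔ b = q + (0, -(len S : ℤ)) := fun b => by
      rw [← eq_sub_iff_add_eq, sub_eq_add_neg, Prod.neg_mk, neg_zero]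
    simp only [h1]

theorem hasBidegree_thetaMul (R : MIdx D) :
    HasBidegree (thetaMul (U := U) R) (1, (len R : ℤ)) := by
  intro q f
  funext T
  ext1 n
  rw [coeff_bidegreePart, thetaMul_apply, thetaMul_apply]
  by_cases hR : R ∈ T
  · have h1 := bidegree_insert n (Finset.notMem_erase R T)
    rw [Finset.insert_erase hR] at h1
    rw [if_pos hR, if_pos hR, coeff_smul_real, coeff_smul_real, coeff_bidegreePart, smul_ite,
      smul_zero]
    simp only [h1, add_left_inj]
  · rw [if_neg hR, if_neg hR, map_zero, ite_self]

theorem hasBidegree_thetaDer (R : MIdx D) :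
    HasBidegree (thetaDer (U := U) R) (-1, -(len R : ℤ)) := by
  intro q f
  funext T
  ext1 n
  rw [coeff_bidegreePart, thetaDer_apply, thetaDer_apply]
  by_cases hR : R ∈ T
  · rw [if_pos hR, if_pos hR, map_zero, ite_self]
  · have h1 : bidegree (insert R T) n = q ↔ bidegree T n = q + (-1, -(len R : ℤ)) := by
      rw [bidegree_insert n hR, ← eq_sub_iff_add_eq, sub_eq_add_neg, Prod.neg_mk]
    rw [if_neg hR, if_neg hR, coeff_smul_real, coeff_smul_real, coeff_bidegreePart, smul_ite,
      smul_zero]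
    simp only [h1]

theorem hasBidegree_partialX (j : Fin D) : HasBidegree (partialX (U := U) j) (0, 1) :=
  hasBidegree_sumOp _ fun S =>
    ((hasBidegree_jetMul _).comp (hasBidegree_jetDer S) (by rw [len_add_xi]; simp)).add
      ((hasBidegree_thetaMul _).comp (hasBidegree_thetaDer S) (by rw [len_add_xi]; simp))

theorem hasBidegree_iota (u₀ : U) (k : Fin D) : HasBidegree (iota u₀ k) (-1, -1) :=
  hasBidegree_sumOp _ fun S =>
    (hasBidegree_centeredMul u₀ S).comp (hasBidegree_thetaDer _) (by rw [len_add_xi]; simp)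

theorem bidegreePart_partialX (j : Fin D) (p d : ℤ) (f : Ahat D U) :
    bidegreePart (p, d) (partialX j f) = partialX j (bidegreePart (p, d - 1) f) := by
  rw [hasBidegree_partialX j (p, d - 1) f, Prod.mk_add_mk, add_zero, sub_add_cancel]

theorem eulerProj_bidegreePart (u₀ : U) (k : Fin D) (q : ℤ × ℤ) (f : Ahat D U) :
    eulerProj u₀ k (bidegreePart q f) = bidegreePart q (eulerProj u₀ k f) := by
  funext T
  ext1 n
  rw [coeff_eulerProj, coeff_bidegreePart, coeff_bidegreePart, coeff_eulerProj]
  split_ifs <;> simp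

/-! ### The space `Θ` as the image of the projection -/

theorem coeff_thetaMonomial (T T' : Finset (MIdx D)) (n : {S : MIdx D // S ≠ 0} →₀ ℕ) :
    MvPowerSeries.coeff n ((thetaMonomial T : Ahat D U) T') =
      if T' = T ∧ n = 0 then 1 else 0 := by
  classical
  rw [thetaMonomial]
  by_cases hT : T' = T
  · subst hT
    rw [Pi.single_eq_same, MvPowerSeries.coeff_one]
    simp
  · rw [Pi.single_eq_of_ne hT, if_neg fun h => hT h.1]
    exact map_zero _

theorem weight_eq_zero_iff {k : Fin D} {T : Finset (MIdx D)} {n : {S : MIdx D // S ≠ 0} →₀ ℕ} :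
    weight k T n = 0 ↔ n = 0 ∧ ∀ S ∈ T, S k = 0 := by
  rw [weight, Nat.add_eq_zero_iff, Finset.sum_eq_zero_iff, Finset.card_eq_zero,
    Finset.filter_eq_empty_iff]
  simp only [ne_eq, not_not]
  refine and_congr ⟨fun h => ?_, fun h => by simp [h]⟩ Iff.rfl
  ext S
  by_contra hS
  exact hS (h S (Finsupp.mem_support_iff.2 hS))

theorem eulerProj_of_mem_Theta (u₀ : U) {k : Fin D} {a : Ahat D U} (ha : a ∈ Theta U k) :
    eulerProj u₀ k a = a := by
  have h : Theta U k ≤ LinearMap.ker (eulerProj u₀ k - LinearMap.id) := by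
    refine Submodule.span_le.2 ?_
    rintro _ ⟨T, hT, rfl⟩
    rw [SetLike.mem_coe, LinearMap.mem_ker, LinearMap.sub_apply, sub_eq_zero]
    funext T'
    ext1 n
    rw [coeff_eulerProj, LinearMap.id_apply, coeff_thetaMonomial]
    by_cases h : T' = T ∧ n = 0
    · rw [if_pos h, if_pos (weight_eq_zero_iff.2 ⟨h.2, h.1 ▸ hT⟩)]
      simp
    · rw [if_neg h]
      simp
  have h1 := LinearMap.mem_ker.1 (h ha)
  rwa [LinearMap.sub_apply, sub_eq_zero] at h1

theorem finite_len_le (D N : ℕ) : {S : MIdx D | len S ≤ N}.Finite :=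
  (Set.finite_Iic fun _ : Fin D => N).subset fun S hS l =>
    (Finset.single_le_sum (f := S) (fun _ _ => Nat.zero_le _) (Finset.mem_univ l)).trans hS

/-- A fixed point of the projection may still be an infinite series. A fixed degree bounds the
length of every multi-index that occurs, leaving finitely many monomials. -/
theorem mem_Theta_of_eulerProj_eq {u₀ : U} {k : Fin D} {p d : ℤ} {f : Ahat D U}
    (hf : f ∈ homog D U p d) (h : eulerProj u₀ k f = f) : f ∈ Theta U k := by
  classical
  -- All candidate monomials. For negative `d` the component is zero, so the truncation by `toNat`
  -- is harmless.
  set F : Finset (Finset (MIdx D)) :=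
    ((finite_len_le D d.toNat).toFinset.powerset).filter fun T => ∀ S ∈ T, S k = 0 with hF
  have h1 : f = ∑ T ∈ F, (MvPowerSeries.coeff 0 (f T) u₀) • thetaMonomial T := by
    funext T'
    ext1 n
    rw [Finset.sum_apply, map_sum]
    simp only [Pi.smul_apply, coeff_smul_real, coeff_thetaMonomial]
    have h2 : MvPowerSeries.coeff n (f T') =
        if weight k T' n = 0 then (MvPowerSeries.coeff n (f T') u₀) • 1 else 0 := by
      conv_lhs => rw [← h]
      exact coeff_eulerProj u₀ k f T' n
    by_cases h0 : MvPowerSeries.coeff n (f T') = 0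
    · rw [h0, eq_comm]
      refine Finset.sum_eq_zero fun T _ => ?_
      split_ifs with hT
      · rw [← hT.1, ← hT.2, h0]
        simp
      · exact smul_zero _
    · have hw : weight k T' n = 0 := by
        by_contra hw
        exact h0 (h2.trans (if_neg hw))
      rw [if_pos hw] at h2
      obtain ⟨hn, hT'⟩ := weight_eq_zero_iff.1 hw
      subst hn
      have hmem : T' ∈ F := by
        rw [hF, Finset.mem_filter, Finset.mem_powerset]
        refine ⟨fun S hS => ?_, hT'⟩
        have h3 := (hf T' 0 h0).2
        have h4 := Finset.single_le_sum (f := len) (fun _ _ => Nat.zero_le _) hS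
        rw [Set.Finite.mem_toFinset]
        change len S ≤ d.toNat
        rw [Finsupp.sum_zero_index] at h3
        omega
      rw [Finset.sum_eq_single_of_mem T' hmem, if_pos ⟨rfl, rfl⟩]
      · exact h2
      · intro T _ hT
        rw [if_neg fun h => hT h.1.symm, smul_zero]
  rw [h1]
  refine Submodule.sum_mem _ fun T hT => Submodule.smul_mem _ _ (Submodule.subset_span ⟨T, ?_, rfl⟩)
  exact (Finset.mem_filter.1 hT).2

theorem thetaMonomial_mem_homog (T : Finset (MIdx D)) :
    (thetaMonomial T : Ahat D U) ∈ homog D U (bidegree T 0).1 (bidegree T 0).2 := by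
  intro T' n h
  rw [coeff_thetaMonomial] at h
  have h1 : T' = T ∧ n = 0 := by
    by_contra h1
    exact h (if_neg h1)
  obtain ⟨rfl, rfl⟩ := h1
  exact ⟨rfl, rfl⟩

theorem bidegreePart_mem_ThetaHomog {k : Fin D} (p d : ℤ) {a : Ahat D U} (ha : a ∈ Theta U k) :
    bidegreePart (p, d) a ∈ ThetaHomog U k p d := by
  refine ⟨?_, bidegreePart_mem_homog p d a⟩
  have h : Theta U k ≤ (Theta U k).comap (bidegreePart (p, d)) := by
    refine Submodule.span_le.2 ?_
    rintro _ ⟨T, hT, rfl⟩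
    rw [SetLike.mem_coe, Submodule.mem_comap, bidegreePart_of_mem_homog (thetaMonomial_mem_homog T)]
    split_ifs
    · exact Submodule.subset_span ⟨T, hT, rfl⟩
    · exact Submodule.zero_mem _
  exact h ha

/-! ### The cohomology of `F̂_i` -/

section Cohomology

variable {k : Fin D} {i : ℕ}

theorem mem_divergences {j : Fin D} (hj : (j : ℕ) < i) (f : Ahat D U) :
    partialX j f ∈ divergences U i :=
  Submodule.mem_iSup_of_mem j (Submodule.mem_iSup_of_mem hj ⟨f, rfl⟩)

theorem thetaDivergencesHomog_le_thetaDivergences (p d : ℤ) :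
    thetaDivergencesHomog U k i p d ≤ thetaDivergences U k i :=
  iSup₂_mono fun _ _ => Submodule.map_mono inf_le_left

theorem thetaDivergences_le_divergences : thetaDivergences U k i ≤ divergences U i :=
  iSup₂_mono fun _ _ => LinearMap.map_le_range

/-- With zero-based indices, `i ≤ k` means that all directions `j < i` differ from `k`. -/
theorem iota_mem_divergences (u₀ : U) (hik : i ≤ k) {f : Ahat D U} (hf : f ∈ divergences U i) :
    iota u₀ k f ∈ divergences U i := by
  have h : divergences U i ≤ (divergences U i).comap (iota u₀ k) := by
    refine iSup₂_le fun j hj => ?_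
    rintro _ ⟨f, rfl⟩
    rw [Submodule.mem_comap, iota_partialX u₀ (Fin.ne_of_lt (hj.trans_le hik))]
    exact mem_divergences hj _
  exact h hf

/-- For `∂_{x^j} f`, the derivative `∂_{x^j} g` of a solution `g` for `f` is a solution. Thus
inverting the Euler operator does not leave the divergences. -/
theorem exists_eulerOp_eq_of_mem_divergences (hU : IsConnected (U : Set ℝ)) (u₀ : U) (hik : i ≤ k)
    {f : Ahat D U} (hf : f ∈ divergences U i) :
    ∃ c ∈ divergences U i, eulerOp u₀ k c = f - eulerProj u₀ k f := by
  have h : divergences U i ≤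
      ((divergences U i).map (eulerOp u₀ k)).comap (LinearMap.id - eulerProj u₀ k) := by
    refine iSup₂_le fun j hj => ?_
    rintro _ ⟨f, rfl⟩
    have hjk : j ≠ k := Fin.ne_of_lt (hj.trans_le hik)
    obtain ⟨g, hg, -⟩ := exists_eulerOp_eq hU u₀ k f
    refine ⟨partialX j g, mem_divergences hj g, ?_⟩
    rw [eulerOp_partialX u₀ hjk, hg, map_sub, LinearMap.sub_apply, LinearMap.id_apply,
      eulerProj_partialX hU u₀ hjk]
  exact h hf

/-- The projection commutes with the relevant total derivatives. Restricting to one bidegree is what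
puts the projected potentials in `Θ` rather than in its completion. -/
theorem bidegreePart_eulerProj_mem (hU : IsConnected (U : Set ℝ)) (u₀ : U) (hik : i ≤ k) (p d : ℤ)
    {f : Ahat D U} (hf : f ∈ divergences U i) :
    bidegreePart (p, d) (eulerProj u₀ k f) ∈ thetaDivergencesHomog U k i p d := by
  have h : divergences U i ≤ (thetaDivergencesHomog U k i p d).comap
      (bidegreePart (p, d) ∘ₗ eulerProj u₀ k) := by
    refine iSup₂_le fun j hj => ?_
    rintro _ ⟨f, rfl⟩
    rw [Submodule.mem_comap, LinearMap.comp_apply,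
      eulerProj_partialX hU u₀ (Fin.ne_of_lt (hj.trans_le hik)), bidegreePart_partialX]
    refine Submodule.mem_iSup_of_mem j (Submodule.mem_iSup_of_mem hj ⟨_, ⟨?_, ?_⟩, rfl⟩)
    · refine mem_Theta_of_eulerProj_eq (u₀ := u₀) (bidegreePart_mem_homog p (d - 1) _) ?_
      rw [eulerProj_bidegreePart,
        eulerProj_eq_self_of_eulerOp_eq_zero hU (eulerOp_eulerProj u₀ k f)]
    · exact bidegreePart_mem_homog p (d - 1) _
  exact h hf

/-- The homotopy formula modulo divergences, with primitive `ι g` for `E g = f - P f`. The remainder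
`ι(Δ g)` must be shown to be a divergence. -/
theorem exists_primitive (hU : IsConnected (U : Set ℝ)) (u₀ : U) (hik : i ≤ k) {p d : ℤ}
    {f : Ahat D U} (hf : f ∈ homog D U p d) (hΔ : Delta k f ∈ divergences U i) :
    ∃ g ∈ homog D U (p - 1) (d - 1), f - eulerProj u₀ k f - Delta k g ∈ divergences U i := by
  obtain ⟨g, hg, hg0⟩ := exists_eulerOp_eq hU u₀ k f
  obtain ⟨c, hc, hc'⟩ := exists_eulerOp_eq_of_mem_divergences hU u₀ hik hΔ
  refine ⟨iota u₀ k g, (hasBidegree_iota u₀ k).map_mem_homog rfl (mem_homog_of_coeff hf hg0), ?_⟩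
  -- Both `Δ g` and the divergence `c` solve `E x = Δ f`.
  have h1 : eulerOp u₀ k (Delta k g - c) = 0 := by
    rw [map_sub, hc', eulerProj_Delta hU, sub_zero, eulerOp_Delta, hg, map_sub, Delta_eulerProj,
      sub_zero, sub_self]
  -- The difference lies in the kernel of `E`, which is the range of the projection and so is killed
  -- by the contraction.
  have h2 : iota u₀ k (Delta k g) = iota u₀ k c := by
    rw [← sub_eq_zero, ← map_sub, ← eulerProj_eq_self_of_eulerOp_eq_zero hU h1, iota_eulerProj]
  rw [← hg, eulerOp_apply, add_sub_cancel_left, h2]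
  exact iota_mem_divergences u₀ hik hc

theorem thetaClass_surjective (hU : IsConnected (U : Set ℝ)) (hik : i ≤ k) (p d : ℤ) :
    Function.Surjective (thetaClass U k i p d) := by
  obtain ⟨x₀, hx₀⟩ := hU.nonempty
  set u₀ : U := ⟨x₀, hx₀⟩
  intro y
  obtain ⟨⟨x, hx⟩, rfl⟩ := Submodule.mkQ_surjective _ y
  obtain ⟨⟨f, hf, rfl⟩, hΔ⟩ := hx
  have hΔ' : Delta k f ∈ divergences U i := (Submodule.Quotient.mk_eq_zero _).1 hΔ
  obtain ⟨g, hg, hfg⟩ := exists_primitive hU u₀ hik hf hΔ'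
  have hP := eulerProj_mem_homog u₀ k hf
  refine ⟨⟨eulerProj u₀ k f, mem_Theta_of_eulerProj_eq hP
    (eulerProj_eq_self_of_eulerOp_eq_zero hU (eulerOp_eulerProj u₀ k f)), hP⟩, ?_⟩
  refine ((Submodule.Quotient.eq _).2 ?_).symm
  refine ⟨(divergences U i).mkQ g, Submodule.mem_map_of_mem hg, ?_⟩
  exact ((Submodule.Quotient.eq _).2 hfg).symm

theorem ker_thetaClass (hU : IsConnected (U : Set ℝ)) (hik : i ≤ k) (p d : ℤ) :
    LinearMap.ker (thetaClass U k i p d) =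
      (thetaDivergencesHomog U k i p d).submoduleOf (ThetaHomog U k p d) := by
  obtain ⟨x₀, hx₀⟩ := hU.nonempty
  set u₀ : U := ⟨x₀, hx₀⟩
  ext a
  rw [LinearMap.mem_ker]
  constructor
  · intro h
    obtain ⟨_, ⟨g, -, rfl⟩, hg⟩ := (Submodule.Quotient.mk_eq_zero _).1 h
    have h1 : Delta k g - a ∈ divergences U i := (Submodule.Quotient.eq _).1 hg
    -- The projection sends `Δ g - a` to `-a`, because it kills `Δ g` and fixes `Θ`.
    have h2 := bidegreePart_eulerProj_mem hU u₀ hik p d h1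
    rw [map_sub, eulerProj_Delta hU, zero_sub, eulerProj_of_mem_Theta u₀ a.2.1, map_neg,
      bidegreePart_of_mem_homog a.2.2, if_pos rfl] at h2
    exact (Submodule.neg_mem_iff _).1 h2
  · intro h
    have h1 : (divergences U i).mkQ (a : Ahat D U) = 0 := (Submodule.Quotient.mk_eq_zero _).2
      (thetaDivergences_le_divergences (thetaDivergencesHomog_le_thetaDivergences p d h))
    refine (Submodule.Quotient.mk_eq_zero _).2 ?_
    change (divergences U i).mkQ (a : Ahat D U) ∈ coboundaries U k i p d
    rw [h1]
    exact Submodule.zero_mem _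

/-- The isomorphism between the quotient of `Θ^p_d` and `H^p_d(F̂_i)`. -/
def thetaClassEquiv (hU : IsConnected (U : Set ℝ)) (hik : i ≤ k) (p d : ℤ) :
    ThetaQuotHomog U k i p d ≃ₗ[ℝ] Cohomology U k i p d :=
  (Submodule.quotEquivOfEq _ _ (ker_thetaClass hU hik p d).symm).trans
    (LinearMap.quotKerEquivOfSurjective _ (thetaClass_surjective hU hik p d))

theorem thetaClassEquiv_mk (hU : IsConnected (U : Set ℝ)) (hik : i ≤ k) (p d : ℤ)
    (a : ThetaHomog U k p d) :
    thetaClassEquiv hU hik p d (Submodule.Quotient.mk a) = thetaClass U k i p d a :=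
  rfl

/-! ### The quotient of `Θ` as a direct sum -/

variable (U k i) in
/-- The natural map from the quotient of `Θ^p_d` to the quotient of `Θ`. -/
def thetaQuotInclusion (q : ℤ × ℤ) : ThetaQuotHomog U k i q.1 q.2 →ₗ[ℝ] ThetaQuot U k i :=
  Submodule.mapQ _ _ (Submodule.inclusion inf_le_left)
    fun _ ha => thetaDivergencesHomog_le_thetaDivergences q.1 q.2 ha

theorem bidegreePart_mem_thetaDivergencesHomog (p d : ℤ) {f : Ahat D U}
    (hf : f ∈ thetaDivergences U k i) :
    bidegreePart (p, d) f ∈ thetaDivergencesHomog U k i p d := by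
  have h : thetaDivergences U k i ≤
      (thetaDivergencesHomog U k i p d).comap (bidegreePart (p, d)) := by
    refine iSup₂_le fun j hj => ?_
    rintro _ ⟨f, hf, rfl⟩
    rw [Submodule.mem_comap, bidegreePart_partialX]
    exact Submodule.mem_iSup_of_mem j (Submodule.mem_iSup_of_mem hj
      ⟨_, bidegreePart_mem_ThetaHomog p (d - 1) hf, rfl⟩)
  exact h hf

variable (U k i) in
/-- The projection from the quotient of `Θ` to the quotient of `Θ^p_d`. -/
def thetaQuotPart (q : ℤ × ℤ) : ThetaQuot U k i →ₗ[ℝ] ThetaQuotHomog U k i q.1 q.2 :=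
  Submodule.mapQ _ _ ((bidegreePart q).restrict fun _ ha => bidegreePart_mem_ThetaHomog q.1 q.2 ha)
    fun _ ha => bidegreePart_mem_thetaDivergencesHomog q.1 q.2 ha

theorem thetaQuotPart_thetaQuotInclusion (q : ℤ × ℤ) (x : ThetaQuotHomog U k i q.1 q.2) :
    thetaQuotPart U k i q (thetaQuotInclusion U k i q x) = x := by
  obtain ⟨a, rfl⟩ := Submodule.mkQ_surjective _ x
  refine congrArg (Submodule.mkQ _) (Subtype.ext ?_)
  exact (bidegreePart_of_mem_homog a.2.2 q).trans (if_pos rfl)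

theorem thetaQuotPart_thetaQuotInclusion_of_ne {q r : ℤ × ℤ} (h : q ≠ r)
    (x : ThetaQuotHomog U k i r.1 r.2) :
    thetaQuotPart U k i q (thetaQuotInclusion U k i r x) = 0 := by
  obtain ⟨a, rfl⟩ := Submodule.mkQ_surjective _ x
  refine (congrArg (Submodule.mkQ _) (Subtype.ext ?_)).trans (map_zero _)
  exact (bidegreePart_of_mem_homog a.2.2 q).trans (if_neg h)

/-- The natural map from `H(F̂_i)` to the quotient of `Θ`. -/
def cohomologyToThetaQuot (hU : IsConnected (U : Set ℝ)) (hik : i ≤ k) :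
    (⨁ q : ℤ × ℤ, Cohomology U k i q.1 q.2) →ₗ[ℝ] ThetaQuot U k i :=
  DirectSum.toModule ℝ _ _ fun q =>
    thetaQuotInclusion U k i q ∘ₗ (thetaClassEquiv hU hik q.1 q.2).symm.toLinearMap

theorem cohomologyToThetaQuot_lof (hU : IsConnected (U : Set ℝ)) (hik : i ≤ k) (p d : ℤ)
    (a : ThetaHomog U k p d) :
    cohomologyToThetaQuot hU hik (DirectSum.lof ℝ (ℤ × ℤ)
      (fun q => Cohomology U k i q.1 q.2) (p, d) (thetaClass U k i p d a)) =
      thetaQuotMk U k i p d a := by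
  rw [cohomologyToThetaQuot, DirectSum.toModule_lof, LinearMap.comp_apply,
    ← thetaClassEquiv_mk hU hik p d a]
  exact congrArg (thetaQuotInclusion U k i (p, d)) (LinearEquiv.symm_apply_apply _ _)

/-- The bidegree parts of the image recover every component of `x`, which yields injectivity. -/
theorem thetaQuotPart_cohomologyToThetaQuot (hU : IsConnected (U : Set ℝ)) (hik : i ≤ k)
    (q : ℤ × ℤ) (x : ⨁ q : ℤ × ℤ, Cohomology U k i q.1 q.2) :
    thetaQuotPart U k i q (cohomologyToThetaQuot hU hik x) =
      (thetaClassEquiv hU hik q.1 q.2).symm (x q) := by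
  have h : thetaQuotPart U k i q ∘ₗ cohomologyToThetaQuot hU hik =
      (thetaClassEquiv hU hik q.1 q.2).symm.toLinearMap ∘ₗ DirectSum.component ℝ _ _ q := by
    refine DirectSum.linearMap_ext ℝ fun r => LinearMap.ext fun y => ?_
    rw [LinearMap.comp_apply, LinearMap.comp_apply, LinearMap.comp_apply, LinearMap.comp_apply,
      cohomologyToThetaQuot, DirectSum.toModule_lof, LinearMap.comp_apply]
    by_cases hqr : q = r
    · subst hqr
      rw [thetaQuotPart_thetaQuotInclusion, DirectSum.component.lof_self]
    · rw [thetaQuotPart_thetaQuotInclusion_of_ne hqr, DirectSum.component.of, dif_neg (Ne.symm hqr),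
        map_zero]
  exact LinearMap.congr_fun h x

theorem cohomologyToThetaQuot_bijective (hU : IsConnected (U : Set ℝ)) (hik : i ≤ k) :
    Function.Bijective (cohomologyToThetaQuot (U := U) hU hik) := by
  constructor
  · intro x y hxy
    refine DFinsupp.ext fun q => (thetaClassEquiv hU hik q.1 q.2).symm.injective ?_
    have h := thetaQuotPart_cohomologyToThetaQuot hU hik q x
    rw [hxy, thetaQuotPart_cohomologyToThetaQuot] at h
    exact h.symm
  · intro y
    obtain ⟨⟨a, ha⟩, rfl⟩ := Submodule.mkQ_surjective _ y
    rw [← LinearMap.mem_range]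
    -- Each spanning monomial of `Θ` is bihomogeneous, so its class comes from a single summand.
    induction ha using Submodule.span_induction with
    | mem a ha =>
      obtain ⟨T, hT, rfl⟩ := ha
      exact ⟨_, cohomologyToThetaQuot_lof hU hik _ _
        ⟨thetaMonomial T, Submodule.subset_span ⟨T, hT, rfl⟩, thetaMonomial_mem_homog T⟩⟩
    | zero => exact Submodule.zero_mem _
    | add a b ha hb iha ihb => exact Submodule.add_mem _ iha ihb
    | smul c a ha iha => exact Submodule.smul_mem _ c iha

end Cohomology

end DNBracket

end

theorem mainTheorem5 (D : ℕ) (U : TopologicalSpace.Opens ℝ) (hU : IsConnected (U : Set ℝ))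
    (k : Fin D) (hk : (k : ℕ) + 1 = D) (i : ℕ) (hi : 1 ≤ i) (hiD : i ≤ D - 1) :
    (∀ p d : ℤ, ∃ e : DNBracket.ThetaQuotHomog U k i p d ≃ₗ[ℝ] DNBracket.Cohomology U k i p d,
      ∀ a : DNBracket.ThetaHomog U k p d,
        e (Submodule.Quotient.mk a) = DNBracket.thetaClass U k i p d a) ∧
    (∃ e : DNBracket.ThetaQuot U k i ≃ₗ[ℝ]
        ⨁ pd : ℤ × ℤ, DNBracket.Cohomology U k i pd.1 pd.2,
      ∀ (p d : ℤ) (a : DNBracket.ThetaHomog U k p d),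
        e (DNBracket.thetaQuotMk U k i p d a) =
          DirectSum.lof ℝ (ℤ × ℤ) (fun pd => DNBracket.Cohomology U k i pd.1 pd.2) (p, d)
            (DNBracket.thetaClass U k i p d a)) := by
  -- Here `k = D - 1` is the zero-based index of the last direction.
  have hik : i ≤ k := by omega
  refine ⟨fun p d => ⟨DNBracket.thetaClassEquiv hU hik p d,
    DNBracket.thetaClassEquiv_mk hU hik p d⟩,
    -- The map out of the direct sum is given by its universal property, so it is constructed in
    -- that direction and then inverted.
    (LinearEquiv.ofBijective _ (DNBracket.cohomologyToThetaQuot_bijective hU hik)).symm,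
    fun p d a => ?_⟩
  rw [LinearEquiv.symm_apply_eq]
  exact (DNBracket.cohomologyToThetaQuot_lof hU hik p d a).symm
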